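/- Let $n\ge 1$ be an integer. For $u,v\in L^2(\mathbb R^n)$ let $$\mathcal W(u,v)(x,\xi)=\int_{\mathbb R^n}e^{-2i\pi z\cdot\xi}\,u(x+\tfrac z2)\,\overline{v(x-\tfrac z2)}\,dz ,\qquad (x,\xi)\in\mathbb R^n\times\mathbb R^n,$$ be the joint Wigner distribution. A bounded operator $Q$ on $L^2(\mathbb R^n)$ is the Weyl quantization $\mathrm{Op}^w(s)$ of a symbol $s$ on $\mathbb R^{2n}$ if $\langle Qu,v\rangle=\iint s\,\mathcal W(u,v)\,dx\,d\xi$ (absolutely convergent) for all Schwartz functions $u,v$. Let $$\psi_k(x)=\frac{(-1)^k}{2^k\sqrt{k!}}\,2^{1/4}e^{\pi x^2}\Bigl(\frac{d}{\sqrt\pi\,dx}\Bigr)^k e^{-2\pi x^2}\quad(k\in\mathbb N),\qquad \Psi_\alpha(x)=\prod_{j=1}^n\psi_{\alpha_j}(x_j)\quad(\alpha\in\mathbb N^n)$$ be the Hermite functions, $\mathbb P_\alpha$ the orthogonal projection of $L^2(\mathbb R^n)$ onto $\mathbb C\Psi_\alpha$, and $\mathbb P_{k;n}=\sum_{|\alpha|=k}\mathbb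 P_\alpha$, where $|\alpha|=\alpha_1+\dots+\alpha_n$. For a real number $\beta$ and $m\in\mathbb N$ let $L_m^\beta(x)=\sum_{l=0}^m\binom{m+\beta}{m-l}\frac{(-1)^l x^l}{l!}$ be the generalized Laguerre polynomial, and let $\Gamma(z,x)=\int_x^{+\infty}t^{z-1}e^{-t}\,dt$ be the upper incomplete Gamma function. For $k\in\mathbb N$ and $a\ge 0$ put $$F_{k;n}(a)=\int_{\mathbb R}\frac{\sin a\tau}{\pi\tau}\,\frac{(1+i\tau)^k}{(1-i\tau)^{k+n}}\,d\tau ,$$ and for $k\in\mathbb N$ and $a\in\mathbb R$ put $$P_{k;n}(a)=\frac{(-1)^{k+n-1}}{2^{n-1}}\int_0^{+\infty}e^{-t}L_{k+n-1}^{1-n}(2t+2a)\,dt .$$ Then $(\Psi_\alpha)_{\alpha\in\mathbb N^n}$ is a Hilbert basis of $L^2(\mathbb R^n)$, each $P_{k;n}$ is a polynomial in $a$, and for every $a\ge 0$ the following hold. 1. For every $k\in\mathbb N$ the integral defining $F_{k;n}(a)$ converges absolutely, $$F_{k;n}(a)=1-e^{-a}P_{k;n}(a)\in\mathbb R\qquad\text{and}\qquad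 F_{k;n}(a)\le 1-\frac{\Gamma(n,a)}{\Gamma(n)} .$$ 2. The indicator function of the Euclidean ball $B_a=\{(x,\xi)\in\mathbb R^{2n}: 2\pi(|x|^2+|\xi|^2)\le a\}$ has a Weyl quantization $\mathcal Q_{a,n}=\mathrm{Op}^w(\mathbf 1_{B_a})$, and this bounded operator on $L^2(\mathbb R^n)$ is unique. It is diagonal in the Hermite basis: $$\mathcal Q_{a,n}=\sum_{k\ge 0}F_{k;n}(a)\,\mathbb P_{k;n}\qquad\text{(strongly convergent)} .$$ 3. In the sense of self-adjoint operators, $\displaystyle \mathcal Q_{a,n}\le 1-\frac{\Gamma(n,a)}{\Gamma(n)}$; for $n=1$ this is Flandrin's bound $\mathcal Q_{a,1}\le 1-e^{-a}$. 4. (Lieb–Ostrover bound.) For every $u\in L^2(\mathbb R^n)$ the function $\mathcal W(u,u)$ is real-valued and integrable on $B_a$, and $$\iint_{B_a}\mathcal W(u,u)(x,\xi)\,dx\,d\xi\le\Bigl(1-\frac{\Gamma(n,a)}{\Gamma(n)}\Bigr)\|u\|_{L^2(\mathbb R^n)}^2 .$$ -/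

import Mathlib

open MeasureTheory
open scoped SchwartzMap

noncomputable section

namespace WeylBall

/-- Configuration space `ℝⁿ` with its Euclidean norm. -/
abbrev Config (n : ℕ) : Type := EuclideanSpace ℝ (Fin n)

/-- The Hilbert space `L²(ℝⁿ)` of complex-valued functions. -/
abbrev L2 (n : ℕ) : Type := Lp ℂ 2 (volume : Measure (Config n))

/-! ### Wigner distribution and Weyl quantization -/

/-- The joint Wigner distribution
`W(u,v)(x,ξ) = ∫ e^{-2iπ z·ξ} u(x + z/2) conj (v(x - z/2)) dz`. -/
def wigner {n : ℕ} (u v : Config n → ℂ) (x ξ : Config n) : ℂ :=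
  ∫ z : Config n, Complex.exp (-2 * Complex.I * Real.pi * (inner ℝ z ξ : ℝ)) *
    u (x + (1 / 2 : ℝ) • z) * (starRingEnd ℂ) (v (x - (1 / 2 : ℝ) • z))

/-- The bounded operator `Q` on `L²(ℝⁿ)` is the Weyl quantization of the symbol `s`, in the weak
sense: `⟨Q u, v⟩ = ∬ s(x,ξ) W(u,v)(x,ξ) dx dξ` for all Schwartz functions `u` and `v`, the integral
being absolutely convergent. (Mathlib's `inner ℂ f g` is conjugate-linear in `f`.) -/
def IsWeylQuantization {n : ℕ} (s : Config n × Config n → ℂ) (Q : L2 n →L[ℂ] L2 n) : Prop :=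
  ∀ u v : 𝓢(Config n, ℂ),
    Integrable (fun p : Config n × Config n => s p * wigner u v p.1 p.2) ∧
    inner ℂ (v.toLp 2 : L2 n) (Q (u.toLp 2)) =
      ∫ p : Config n × Config n, s p * wigner u v p.1 p.2

/-- The Euclidean ball `{(x,ξ) : 2π(|x|² + |ξ|²) ≤ a}` of the phase space `ℝⁿ × ℝⁿ`. -/
def phaseBall (n : ℕ) (a : ℝ) : Set (Config n × Config n) :=
  {p | 2 * Real.pi * (‖p.1‖ ^ 2 + ‖p.2‖ ^ 2) ≤ a}

/-- The indicator function of the ball, as a complex-valued symbol. -/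
def ballSymbol (n : ℕ) (a : ℝ) : Config n × Config n → ℂ :=
  (phaseBall n a).indicator 1

/-! ### Hermite functions and the associated projections -/

/-- The one-dimensional Hermite function of level `k`,
`ψ_k(x) = (-1)^k / (2^k √(k!)) · 2^{1/4} · e^{π x²} (d / (√π dx))^k e^{-2π x²}`. -/
def hermiteFun (k : ℕ) (x : ℝ) : ℝ :=
  (-1) ^ k / (2 ^ k * √(k.factorial : ℝ)) * (2 : ℝ) ^ (1 / 4 : ℝ) * Real.exp (Real.pi * x ^ 2) *
    ((1 / √Real.pi) ^ k * iteratedDeriv k (fun y : ℝ => Real.exp (-2 * Real.pi * y ^ 2)) x)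

/-- The `n`-dimensional Hermite function `Ψ_α(x) = ∏ ψ_{α_j}(x_j)`. -/
def hermiteFunN {n : ℕ} (α : Fin n → ℕ) (x : Config n) : ℂ :=
  ∏ j, (hermiteFun (α j) (x j) : ℂ)

theorem hermiteFun_eq (k : ℕ) (x : ℝ) :
    hermiteFun k x = (2 : ℝ) ^ (1 / 4 : ℝ) / √(k.factorial : ℝ) *
      Polynomial.aeval (2 * √Real.pi * x) (Polynomial.hermite k) *
        Real.exp (-(Real.pi * x ^ 2)) := by
  have hs : (√Real.pi) ^ 2 = Real.pi := Real.sq_sqrt Real.pi_pos.le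
  have hs0 : √Real.pi ≠ 0 := (Real.sqrt_pos.2 Real.pi_pos).ne'
  have h1 : (fun y : ℝ => Real.exp (-2 * Real.pi * y ^ 2)) =
      fun y : ℝ => (fun w : ℝ => Real.exp (-(w ^ 2 / 2))) ((2 * √Real.pi) * y) := by
    funext y
    simp only
    congr 1
    rw [mul_pow, mul_pow, hs]
    ring
  have h2 : ContDiff ℝ k (fun w : ℝ => Real.exp (-(w ^ 2 / 2))) := by fun_prop
  have h3 : iteratedDeriv k (fun y : ℝ => Real.exp (-2 * Real.pi * y ^ 2)) x =
      (2 * √Real.pi) ^ k * ((-1 : ℝ) ^ k *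
        Polynomial.aeval (2 * √Real.pi * x) (Polynomial.hermite k) *
          Real.exp (-(2 * Real.pi * x ^ 2))) := by
    rw [h1, iteratedDeriv_comp_const_mul h2, iteratedDeriv_eq_iterate]
    simp only [Polynomial.deriv_gaussian_eq_hermite_mul_gaussian]
    congr 3
    rw [mul_pow, mul_pow, hs]
    ring
  have h4 : Real.exp (-(Real.pi * x ^ 2)) =
      Real.exp (Real.pi * x ^ 2) * Real.exp (-(2 * Real.pi * x ^ 2)) := by
    rw [← Real.exp_add]
    congr 1
    ring
  have h5 : ((-1 : ℝ) ^ k) * (-1) ^ k = 1 := by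
    rw [← mul_pow]
    simp
  have hf : √(k.factorial : ℝ) ≠ 0 :=
    (Real.sqrt_pos.2 (by exact_mod_cast k.factorial_pos)).ne'
  rw [hermiteFun, h3, h4, mul_pow, div_pow, one_pow]
  generalize Polynomial.aeval (2 * √Real.pi * x) (Polynomial.hermite k) = A
  field_simp
  linear_combination A * h5

theorem continuous_hermiteFun (k : ℕ) : Continuous (hermiteFun k) := by
  have h : hermiteFun k = _ := funext (hermiteFun_eq k)
  rw [h]
  have := (Polynomial.hermite k).continuous_aeval (A := ℝ)
  fun_prop

theorem integrable_hermiteFun_sq (k : ℕ) : Integrable (fun x => hermiteFun k x ^ 2) := by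
  have key : ∀ p : Polynomial ℝ,
      Integrable (fun x : ℝ => p.eval x * Real.exp (-(2 * Real.pi) * x ^ 2)) := by
    intro p
    induction p using Polynomial.induction_on' with
    | add p q hp hq =>
      simp only [Polynomial.eval_add, add_mul]
      exact hp.add hq
    | monomial m c =>
      have h := integrable_rpow_mul_exp_neg_mul_sq (b := 2 * Real.pi) (by positivity)
        (s := (m : ℝ)) (by have : (0 : ℝ) ≤ m := m.cast_nonneg
                           linarith)
      have h' := h.const_mul c
      refine h'.congr (Filter.Eventually.of_forall fun x => ?_)
      simp only [Polynomial.eval_monomial, Real.rpow_natCast]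
      ring
  let c : ℝ := (2 : ℝ) ^ (1 / 4 : ℝ) / √(k.factorial : ℝ)
  let p : Polynomial ℝ := (((Polynomial.hermite k).map (Int.castRingHom ℝ)).comp
    (Polynomial.C (2 * √Real.pi) * Polynomial.X)) ^ 2
  refine ((key p).const_mul (c ^ 2)).congr (Filter.Eventually.of_forall fun x => ?_)
  have he : Real.exp (-(2 * Real.pi) * x ^ 2) = Real.exp (-(Real.pi * x ^ 2)) ^ 2 := by
    rw [← Real.exp_nat_mul]
    congr 1
    push_cast
    ring
  have hp : p.eval x = (Polynomial.aeval (2 * √Real.pi * x) (Polynomial.hermite k)) ^ 2 := by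
    simp [p, Polynomial.eval_comp, Polynomial.aeval_def, Polynomial.eval_map]
  simp only [hermiteFun_eq, hp, he, c]
  ring

theorem memLp_hermiteFunN {n : ℕ} (α : Fin n → ℕ) :
    MemLp (hermiteFunN α) 2 (volume : Measure (Config n)) := by
  have hc : Continuous (hermiteFunN α) := by
    unfold hermiteFunN
    refine continuous_finsetProd _ fun j _ => ?_
    have := continuous_hermiteFun (α j)
    fun_prop
  rw [memLp_two_iff_integrable_sq_norm hc.aestronglyMeasurable]
  have h : Integrable (fun x : Fin n → ℝ => ∏ j, hermiteFun (α j) (x j) ^ 2) :=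
    Integrable.fintype_prod (f := fun j (t : ℝ) => hermiteFun (α j) t ^ 2)
      fun j => integrable_hermiteFun_sq (α j)
  have h' := (PiLp.volume_preserving_ofLp (Fin n)).integrable_comp_of_integrable h
  refine h'.congr (Filter.Eventually.of_forall fun x => ?_)
  simp [hermiteFunN, norm_prod, Finset.prod_pow, ← Finset.abs_prod]

/-- `Ψ_α` as an element of `L²(ℝⁿ)`. -/
def hermiteL2 {n : ℕ} (α : Fin n → ℕ) : L2 n := (memLp_hermiteFunN α).toLp _

/-- `P_α`, the orthogonal projection of `L²(ℝⁿ)` onto the line spanned by `Ψ_α`. -/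
def hermiteProj {n : ℕ} (α : Fin n → ℕ) : L2 n →L[ℂ] L2 n :=
  (Submodule.span ℂ {hermiteL2 α}).starProjection

/-- `P_{k;n} = ∑_{|α| = k} P_α`. -/
def levelProj (n k : ℕ) : L2 n →L[ℂ] L2 n :=
  ∑ α ∈ Finset.piAntidiag (Finset.univ : Finset (Fin n)) k, hermiteProj α

/-! ### The coefficients -/

/-- The integrand `sin(aτ)/(πτ) · (1+iτ)^k / (1-iτ)^{k+n}`. -/
def coeffIntegrand (k n : ℕ) (a τ : ℝ) : ℂ :=
  ((Real.sin (a * τ) / (Real.pi * τ) : ℝ) : ℂ) *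
    ((1 + Complex.I * τ) ^ k / (1 - Complex.I * τ) ^ (k + n))

/-- `F_{k;n}(a) = ∫_ℝ sin(aτ)/(πτ) · (1+iτ)^k / (1-iτ)^{k+n} dτ`. -/
def ballCoeff (k n : ℕ) (a : ℝ) : ℂ := ∫ τ : ℝ, coeffIntegrand k n a τ

/-- The generalized Laguerre polynomial
`L_m^β(x) = ∑_{l ≤ m} binom(m+β, m-l) (-1)^l x^l / l!`, where `binom` is the generalized binomial
coefficient `Ring.choose`. -/
def laguerre (m : ℕ) (β x : ℝ) : ℝ :=
  ∑ l ∈ Finset.range (m + 1),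
    Ring.choose ((m : ℝ) + β) (m - l) * ((-1) ^ l * x ^ l / (l.factorial : ℝ))

/-- `P_{k;n}(a) = (-1)^{k+n-1} / 2^{n-1} · ∫_0^∞ e^{-t} L_{k+n-1}^{1-n}(2t+2a) dt`, for `n ≥ 1`. -/
def laguerreP (k n : ℕ) (a : ℝ) : ℝ :=
  (-1) ^ (k + n - 1) / 2 ^ (n - 1) *
    ∫ t in Set.Ioi (0 : ℝ), Real.exp (-t) * laguerre (k + n - 1) (1 - n) (2 * t + 2 * a)

/-- The upper incomplete Gamma function `Γ(z,x) = ∫_x^∞ t^{z-1} e^{-t} dt` (real arguments). -/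
def upperGamma (z x : ℝ) : ℝ := ∫ t in Set.Ioi x, t ^ (z - 1) * Real.exp (-t)

end WeylBall

end

open MeasureTheory
open scoped SchwartzMap

noncomputable section

namespace WeylBall

/-! ### Positivity of the alternating sums of Laguerre polynomials -/

/-! The modulated Gaussians g_t(x) = exp(-π|x|² + 2πi t·x) serve as a generating family; the Wigner
functions of the Ψ_α are never computed. Put c(s,t) = 2^{-n/2} exp(-π(|s|² + |t|²)/2). On the
Hermite side, ⟨Ψ_α, g_t⟩ is a monomial in t times a Gaussian, and the multinomial theorem gives
Σ_{|α|=k} ⟨g_s, Ψ_α⟩⟨Ψ_α, g_t⟩ = c(s,t) (π s·t)^k / k! (`sum_level_inner_modGaussL2`). On the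
phase-space side, with ρ = 2π(|x|² + |ξ|²), the integral of e^{iτρ} W(g_t, g_s) is c(s,t)
(1-iτ)^{-n} exp(π s·t (1+iτ)/(1-iτ)) (`integral_wigner_modGauss_mul`). One-variable Fourier
inversion in ρ (`setIntegral_abs_le_eq_integral_sincKer`) turns the integral over the ball into the
integral of this function against sin(aτ)/(πτ), and expanding the exponential yields Σ_k F_{k;n}(a)
c(s,t) (π s·t)^k / k!. So the diagonal operator with eigenvalues F_{|α|;n}(a) and the form given by
integrating W over the ball agree on the g_t. Both are bounded and the g_t are total, hence they
agree on L².

Totality holds because ⟨g_t, u⟩ is the Fourier transform of e^{-π|x|²}u at t. The Hermite functions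
are complete because the case s = t, summed over k, is Parseval's equality for each g_t. The form is
bounded because |W(u,v)| ≤ 2^n ‖u‖ ‖v‖ pointwise and the ball is compact; density of Schwartz
functions then identifies Weyl quantizations with operators representing the form, which gives
uniqueness.

For the coefficients, (1+iτ)/(1-iτ) = 2/(1-iτ) - 1 gives a recurrence lowering k and raising n, and
Pascal's rule for Laguerre polynomials gives the same one for P_{k;n}. The case k = 0 is the Gamma
distribution, with characteristic function (1-iτ)^{-n}.

The upper bound amounts to P_{k;n} ≥ P_{0;n} on [0,∞) (`polyP_zero_le`). All P_{k;n} equal 1 at 0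
and P_{k;n+1}' = P_{k;n}, which reduces the claim to n = 1, where P_{k+1;1}'(a) = 2 Σ_{j≤k} (-1)^j
L_j(2a). These sums are nonnegative (`altLagSum_nonneg`): their generating function (1-z²)^{-1}
exp(xz/(1+z)) is (1-z²)^{-1/2} times Mehler's series Σ He_l(√x)² z^l / l!. -/

open PowerSeries in
theorem powerSeries_eq_zero_of_ode {A K V : PowerSeries ℝ} (hA : constantCoeff A = 1)
    (hV : constantCoeff V = 0) (h : A * derivative ℝ V = K * V) : V = 0 := by
  obtain ⟨B, hB⟩ : ∃ B : PowerSeries ℝ, B * A = 1 := by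
    have : IsUnit A := PowerSeries.isUnit_iff_constantCoeff.2 (by simp [hA])
    exact this.exists_left_inv
  have h' : derivative ℝ V = (B * K) * V := by
    rw [mul_assoc, ← h, ← mul_assoc, hB, one_mul]
  ext m
  induction m using Nat.strong_induction_on with
  | _ m ih =>
    cases m with
    | zero => simpa using hV
    | succ m =>
      -- The left coefficient is (m+1) v_{m+1}; the right one involves only v_0, …, v_m, which
      -- vanish by induction.
      have := congrArg (coeff m) h'
      rw [coeff_derivative, coeff_mul, Finset.sum_eq_zero] at this
      · have hm : (m : ℝ) + 1 ≠ 0 := by positivity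
        simpa [hm] using this
      · intro p hp
        have hp' := Finset.HasAntidiagonal.mem_antidiagonal.1 hp
        rw [ih p.2 (by omega)]
        simp

/-- The probabilists' Hermite polynomials at `y`, by their three-term recurrence. -/
def heSeq (y : ℝ) : ℕ → ℝ
  | 0 => 1
  | 1 => y
  | (l + 2) => y * heSeq y (l + 1) - (l + 1) * heSeq y l

/-- The coefficients of `(1 - z²)^{-1/2}`. -/
def invSqrtCoeff : ℕ → ℝ
  | 0 => 1
  | 1 => 0
  | (l + 2) => (l + 1) / (l + 2) * invSqrtCoeff l

theorem invSqrtCoeff_nonneg : ∀ l, 0 ≤ invSqrtCoeff l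
  | 0 => zero_le_one
  | 1 => le_rfl
  | (l + 2) => mul_nonneg (by positivity) (invSqrtCoeff_nonneg l)

open PowerSeries in
theorem invSqrt_ode :
    (1 - X ^ 2) * derivative ℝ (mk invSqrtCoeff) = X * mk invSqrtCoeff := by
  ext m
  rw [sub_mul, one_mul, map_sub]
  rcases m with _ | _ | m
  · simp [coeff_derivative, invSqrtCoeff]
  · rw [pow_two, mul_assoc, coeff_succ_X_mul, coeff_succ_X_mul]
    simp [coeff_derivative, invSqrtCoeff]
    norm_num
  · rw [pow_two, mul_assoc, coeff_succ_X_mul, coeff_succ_X_mul, coeff_succ_X_mul]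
    simp [coeff_derivative, invSqrtCoeff]
    field_simp
    ring

-- Mehler's formula on the diagonal, in differential form: the series is (1-z²)^{-1/2}
-- exp(y²z/(1+z)), with logarithmic derivative z/(1-z²) + y²/(1+z)². The factor (1-z²)(1+z) clears
-- the denominators.
open PowerSeries in
theorem heSeq_sq_ode (y : ℝ) :
    ((1 - X ^ 2) * (1 + X)) * derivative ℝ (mk fun l => heSeq y l ^ 2 / (l.factorial : ℝ)) =
      ((1 + X) * X + C (y ^ 2) * (1 - X)) * mk fun l => heSeq y l ^ 2 / (l.factorial : ℝ) := by
  -- Products are spread into nested multiplications by `X`, the shape in which `coeff_succ_X_mul`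
  -- reads off coefficients.
  have h1 : ∀ D : PowerSeries ℝ, ((1 - X ^ 2) * (1 + X)) * D =
      D + X * D - X * (X * D) - X * (X * (X * D)) := fun D => by ring
  obtain ⟨c, hc⟩ : ∃ c, y ^ 2 = c := ⟨_, rfl⟩
  have h2 : ∀ D : PowerSeries ℝ, ((1 + X) * X + C (y ^ 2) * (1 - X)) * D =
      X * D + X * (X * D) + C c * D - C c * (X * D) := fun D => by rw [hc]; ring
  rw [h1, h2]
  ext m
  rcases m with _ | _ | _ | m <;>
    simp only [map_add, map_sub, coeff_zero_X_mul, coeff_succ_X_mul, coeff_derivative, coeff_mk,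
      coeff_C_mul, heSeq, Nat.factorial_succ, Nat.factorial_zero, ← hc]
  · norm_num
  · norm_num
    ring
  · norm_num
    ring
  · have : (m.factorial : ℝ) ≠ 0 := by positivity
    push_cast
    field_simp
    ring

/-- The polynomial `L_m^β`. -/
def lagPoly (m : ℕ) (β : ℝ) : Polynomial ℝ :=
  ∑ l ∈ Finset.range (m + 1),
    Polynomial.monomial l (Ring.choose ((m : ℝ) + β) (m - l) * ((-1) ^ l / (l.factorial : ℝ)))

theorem eval_lagPoly (m : ℕ) (β x : ℝ) : (lagPoly m β).eval x = laguerre m β x := by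
  simp only [lagPoly, laguerre, Polynomial.eval_finsetSum, Polynomial.eval_monomial]
  exact Finset.sum_congr rfl fun l _ => by ring

theorem coeff_lagPoly (m : ℕ) (β : ℝ) (l : ℕ) : (lagPoly m β).coeff l =
    if l ≤ m then Ring.choose ((m : ℝ) + β) (m - l) * ((-1) ^ l / (l.factorial : ℝ)) else 0 := by
  simp [lagPoly, Polynomial.finsetSum_coeff, Polynomial.coeff_monomial]

theorem lagPoly_succ (m : ℕ) (β : ℝ) :
    lagPoly (m + 1) β = lagPoly (m + 1) (β + 1) - lagPoly m (β + 1) := by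
  ext l
  rw [Polynomial.coeff_sub, coeff_lagPoly, coeff_lagPoly, coeff_lagPoly]
  have e : ((m + 1 : ℕ) : ℝ) + (β + 1) = ((m : ℝ) + (β + 1)) + 1 := by push_cast; ring
  have e' : ((m + 1 : ℕ) : ℝ) + β = (m : ℝ) + (β + 1) := by push_cast; ring
  rw [e, e']
  rcases lt_trichotomy l (m + 1) with h | h | h
  · rw [if_pos h.le, if_pos h.le, if_pos (Nat.lt_succ_iff.1 h), Nat.succ_sub (Nat.lt_succ_iff.1 h),
      Nat.succ_eq_add_one, Ring.choose_succ_succ]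
    ring
  · subst h
    simp
  · rw [if_neg (by omega), if_neg (by omega), if_neg (by omega), sub_zero]

theorem derivative_lagPoly_succ (m : ℕ) (β : ℝ) :
    Polynomial.derivative (lagPoly (m + 1) β) = -lagPoly m (β + 1) := by
  ext l
  rw [Polynomial.coeff_derivative, Polynomial.coeff_neg, coeff_lagPoly, coeff_lagPoly]
  have e' : ((m + 1 : ℕ) : ℝ) + β = (m : ℝ) + (β + 1) := by push_cast; ring
  rw [e']
  by_cases h : l ≤ m
  · rw [if_pos h, if_pos (by omega), Nat.add_sub_add_right, Nat.factorial_succ]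
    have : (l.factorial : ℝ) ≠ 0 := by positivity
    push_cast
    field_simp
    ring
  · rw [if_neg h, if_neg (by omega)]
    simp

theorem coeff_lagPoly_zero (m l : ℕ) :
    (lagPoly m 0).coeff l = (m.choose l : ℝ) * ((-1) ^ l / (l.factorial : ℝ)) := by
  rw [coeff_lagPoly, add_zero]
  split_ifs with h
  · rw [Ring.choose_natCast, Nat.choose_symm h]
  · rw [Nat.choose_eq_zero_of_lt (by omega)]
    simp

theorem lagPoly_zero_zero : lagPoly 0 0 = 1 := by
  ext l
  rcases l with _ | l <;> simp [coeff_lagPoly_zero, Polynomial.coeff_one]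

theorem lagPoly_one_zero : lagPoly 1 0 = 1 - Polynomial.X := by
  ext l
  rcases l with _ | _ | l <;>
    simp [coeff_lagPoly_zero, Polynomial.coeff_one, Polynomial.coeff_X, Nat.choose_eq_zero_of_lt]

theorem lagPoly_three_term (m : ℕ) :
    ((m : ℝ) + 2) • lagPoly (m + 2) 0 = (2 * (m : ℝ) + 3) • lagPoly (m + 1) 0 -
      Polynomial.X * lagPoly (m + 1) 0 - ((m : ℝ) + 1) • lagPoly m 0 := by
  ext l
  rcases l with _ | l
  · simp [coeff_lagPoly_zero]
    ring
  · simp only [Polynomial.coeff_sub, Polynomial.coeff_smul, Polynomial.coeff_X_mul,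
      coeff_lagPoly_zero, smul_eq_mul, Nat.factorial_succ]
    have h0 : (l.factorial : ℝ) ≠ 0 := by positivity
    have h1 : (((m + 2).choose (l + 1) : ℕ) : ℝ) =
        ((m + 1).choose l : ℝ) + ((m + 1).choose (l + 1) : ℝ) := by
      exact_mod_cast Nat.choose_succ_succ (m + 1) l
    have h2 : (((m + 1).choose (l + 1) : ℕ) : ℝ) = (m.choose l : ℝ) + (m.choose (l + 1) : ℝ) := by
      exact_mod_cast Nat.choose_succ_succ m l
    have h3 : ((m : ℝ) + 1) * (m.choose l : ℝ) = ((m + 1).choose (l + 1) : ℝ) * (l + 1) := by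
      exact_mod_cast Nat.add_one_mul_choose_eq m l
    have h4 : ((m : ℝ) + 1 + 1) * ((m + 1).choose l : ℝ) =
        (((m + 1).choose l : ℝ) + ((m + 1).choose (l + 1) : ℝ)) * (l + 1) := by
      rw [← h1]
      exact_mod_cast Nat.add_one_mul_choose_eq (m + 1) l
    rw [h1]
    push_cast
    field_simp
    ring_nf at h2 h3 h4 ⊢
    linear_combination (-(-1 : ℝ) ^ l) * (h4 - h3 - ((m : ℝ) + 1) * h2)

/-- `∑_{j ≤ m} (-1)^j L_j(x)`. -/
def altLagSum (x : ℝ) (m : ℕ) : ℝ :=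
  ∑ j ∈ Finset.range (m + 1), (-1) ^ j * (lagPoly j 0).eval x

-- The Laguerre series at -z is (1+z)^{-1} exp(xz/(1+z)), and partial sums divide it by 1-z. Here
-- `h2` encodes the three-term recurrence and `h1` the passage to partial sums.
open PowerSeries in
theorem altLagSum_ode (x : ℝ) :
    ((1 - X ^ 2) * (1 + X)) * derivative ℝ (mk (altLagSum x)) =
      (2 * (1 + X) * X + C x * (1 - X)) * mk (altLagSum x) := by
  set T := mk (altLagSum x) with hT
  set L : PowerSeries ℝ := mk fun j => (-1) ^ j * (lagPoly j 0).eval x with hL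
  have h1 : (1 - X) * T = L := by
    ext m
    rw [sub_mul, one_mul, map_sub]
    rcases m with _ | m
    · simp [hT, hL, altLagSum]
    · rw [coeff_succ_X_mul]
      simp only [hT, hL, coeff_mk, altLagSum]
      rw [Finset.sum_range_succ (n := m + 1)]
      ring
  have h2 : (1 + X) ^ 2 * derivative ℝ L = (C (x - 1) - X) * L := by
    obtain ⟨c, hc⟩ : ∃ c, x - 1 = c := ⟨_, rfl⟩
    have e1 : ∀ D : PowerSeries ℝ, (1 + X) ^ 2 * D = D + X * D + X * D + X * (X * D) :=
      fun D => by ring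
    rw [e1, sub_mul, hc]
    ext m
    rcases m with _ | _ | m <;>
      simp only [hL, map_add, map_sub, coeff_zero_X_mul, coeff_succ_X_mul, coeff_derivative,
        coeff_mk, coeff_C_mul] <;>
      simp only [← hc, zero_add, lagPoly_zero_zero, lagPoly_one_zero,
        Polynomial.eval_sub, Polynomial.eval_one, Polynomial.eval_X]
    · norm_num
    · have := congrArg (Polynomial.eval x) (lagPoly_three_term 0)
      simp [lagPoly_zero_zero, lagPoly_one_zero] at this
      norm_num
      linear_combination this
    · have := congrArg (Polynomial.eval x) (lagPoly_three_term (m + 1))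
      simp only [Polynomial.eval_smul, Polynomial.eval_sub, Polynomial.eval_mul, Polynomial.eval_X,
        smul_eq_mul] at this
      push_cast at this ⊢
      ring_nf at this ⊢
      linear_combination (-(-1 : ℝ) ^ m) * this
  rw [← h1, Derivation.leibniz] at h2
  simp only [map_sub, Derivation.map_one_eq_zero, derivative_X, smul_eq_mul, map_one] at h2
  linear_combination h2

/-- By uniqueness for the differential equation, the generating function is the product of Mehler's
series at √x and (1-z²)^{-1/2}, both with nonnegative coefficients. -/
theorem altLagSum_nonneg {x : ℝ} (hx : 0 ≤ x) (m : ℕ) : 0 ≤ altLagSum x m := by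
  open PowerSeries in
  set y := √x
  have hy : y ^ 2 = x := Real.sq_sqrt hx
  set H : PowerSeries ℝ := mk fun l => heSeq y l ^ 2 / (l.factorial : ℝ) with hH
  set B : PowerSeries ℝ := mk invSqrtCoeff with hB
  have h1 := heSeq_sq_ode y
  have h2 := invSqrt_ode
  have h3 := altLagSum_ode x
  rw [hy, ← hH] at h1
  rw [← hB] at h2
  have key : mk (altLagSum x) - H * B = 0 := by
    refine powerSeries_eq_zero_of_ode (A := (1 - X ^ 2) * (1 + X))
      (K := 2 * (1 + X) * X + C x * (1 - X)) (by simp) ?_ ?_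
    · rw [map_sub, map_mul]
      simp only [← coeff_zero_eq_constantCoeff_apply, hH, hB, coeff_mk]
      simp [altLagSum, heSeq, invSqrtCoeff, lagPoly_zero_zero]
    · rw [map_sub, Derivation.leibniz]
      simp only [smul_eq_mul]
      linear_combination h3 - B * h1 - H * (1 + X) * h2
  have h4 : altLagSum x m = coeff m (H * B) := by
    rw [← sub_eq_zero.1 key, coeff_mk]
  rw [h4, coeff_mul]
  refine Finset.sum_nonneg fun p _ => ?_
  rw [hH, hB, coeff_mk, coeff_mk]
  exact mul_nonneg (by positivity) (invSqrtCoeff_nonneg _)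

/-! ### The polynomials `P_{k;n}` -/

-- The inverse of 1 - D is the Neumann series Σ D^i, which terminates on polynomials.
open Polynomial in
theorem exists_sub_derivative_eq (q : ℝ[X]) : ∃ r : ℝ[X], r - derivative r = q := by
  refine ⟨∑ i ∈ Finset.range (q.natDegree + 1), derivative^[i] q, ?_⟩
  rw [derivative_sum, ← Finset.sum_sub_distrib]
  simp only [← Function.iterate_succ_apply' derivative]
  rw [Finset.sum_range_sub', iterate_derivative_eq_zero (Nat.lt_succ_self _), sub_zero]
  rfl

-- Differentiation lowers the degree, so 1 - D is injective. Identities among the P_{k;n} are proved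
-- below by applying 1 - D, that is, on the integrands.
open Polynomial in
theorem eq_of_sub_derivative_eq {r s : ℝ[X]} (h : r - derivative r = s - derivative s) :
    r = s := by
  by_contra hne
  have hd : r - s ≠ 0 := sub_ne_zero.2 hne
  have h1 : r - s = derivative (r - s) := by
    rw [derivative_sub]
    linear_combination h
  have := degree_derivative_lt hd
  rw [← h1] at this
  exact lt_irrefl _ this

open Polynomial Filter Topology in
theorem integrableOn_exp_neg_mul_eval (q : ℝ[X]) (a : ℝ) :
    IntegrableOn (fun t => Real.exp (-t) * q.eval (t + a)) (Set.Ioi 0) := by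
  refine integrable_of_isBigO_exp_neg (b := 1 / 2) (by norm_num) ?_ ?_
  · have := q.continuous
    fun_prop
  · have h1 := ((q.comp (C 2 * X + C a)).tendsto_div_exp_atTop).comp
      (tendsto_id.atTop_div_const (zero_lt_two : (0 : ℝ) < 2))
    have h2 : (fun t : ℝ => Real.exp (-t) * q.eval (t + a)) =
        fun t => (eval (t / 2) (q.comp (C 2 * X + C a)) / Real.exp (t / 2)) *
          Real.exp (-(1 / 2) * t) := by
      funext t
      rw [div_eq_mul_inv, ← Real.exp_neg, mul_assoc, ← Real.exp_add, mul_comm]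
      simp only [eval_comp, eval_add, eval_mul, eval_C, eval_X]
      ring_nf
    rw [h2]
    have h3 : (fun t : ℝ => eval (t / 2) (q.comp (C 2 * X + C a)) / Real.exp (t / 2))
        =O[atTop] (fun _ => (1 : ℝ)) := h1.isBigO_one ℝ
    simpa using h3.mul (Asymptotics.isBigO_refl (fun t : ℝ => Real.exp (-(1 / 2) * t)) atTop)

-- An antiderivative is -e^{-t} r(t+a): integration against e^{-t} inverts 1 - D, which is why
-- P_{k;n} is a polynomial.
open Polynomial Filter Topology in
theorem integral_exp_neg_mul_eval (r : ℝ[X]) (a : ℝ) :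
    ∫ t in Set.Ioi (0 : ℝ), Real.exp (-t) * (r - derivative r).eval (t + a) = r.eval a := by
  have h := integral_Ioi_of_hasDerivAt_of_tendsto' (a := 0) (m := 0)
    (f := fun t => -(Real.exp (-t) * r.eval (t + a)))
    (f' := fun t => Real.exp (-t) * (r - derivative r).eval (t + a)) ?_
    (integrableOn_exp_neg_mul_eval _ a) ?_
  · rw [h]
    simp
  · intro t _
    have h1 : HasDerivAt (fun t => Real.exp (-t)) (-Real.exp (-t)) t := by
      simpa using (hasDerivAt_neg t).exp
    have h2 : HasDerivAt (fun t => r.eval (t + a)) ((derivative r).eval (t + a)) t :=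
      (r.hasDerivAt (t + a)).comp_add_const t a
    convert! (h1.mul h2).neg using 1
    simp
    ring
  · have h1 := (r.comp (X + C a)).tendsto_div_exp_atTop.neg
    rw [neg_zero] at h1
    refine h1.congr fun t => ?_
    simp [Real.exp_neg, div_eq_inv_mul]

/-- The polynomial under the integral sign in `P_{k;m+1}`. -/
def integrandP (k m : ℕ) : Polynomial ℝ :=
  Polynomial.C ((-1) ^ (k + m) / 2 ^ m) * (lagPoly (k + m) (-m)).comp (2 * Polynomial.X)

/-- `P_{k;m+1}` as a polynomial. -/
def polyP (k m : ℕ) : Polynomial ℝ := (exists_sub_derivative_eq (integrandP k m)).choose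

theorem polyP_spec (k m : ℕ) :
    polyP k m - Polynomial.derivative (polyP k m) = integrandP k m :=
  (exists_sub_derivative_eq (integrandP k m)).choose_spec

theorem laguerreP_eq_eval (k m : ℕ) (a : ℝ) : laguerreP k (m + 1) a = (polyP k m).eval a := by
  rw [← integral_exp_neg_mul_eval, polyP_spec, laguerreP, ← integral_const_mul]
  refine setIntegral_congr_fun measurableSet_Ioi fun t _ => ?_
  simp only [integrandP, Polynomial.eval_mul, Polynomial.eval_C, Polynomial.eval_comp,
    Polynomial.eval_ofNat, Polynomial.eval_X, eval_lagPoly]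
  have e : (1 - ((m + 1 : ℕ) : ℝ)) = -m := by push_cast; ring
  rw [e, mul_add, ← add_assoc, Nat.add_sub_cancel, Nat.add_sub_cancel]
  ring

/-- Pascal's rule `lagPoly_succ` on the integrands. The coefficients F satisfy the same recurrence,
see `ballCoeff_succ_left`. -/
theorem polyP_succ_right (k m : ℕ) :
    polyP k (m + 1) = Polynomial.C (1 / 2) * (polyP k m + polyP (k + 1) m) := by
  apply eq_of_sub_derivative_eq
  have h : integrandP k (m + 1) =
      Polynomial.C (1 / 2) * (integrandP k m + integrandP (k + 1) m) := by
    rw [integrandP, integrandP, integrandP, ← add_assoc, lagPoly_succ (k + m),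
      show k + 1 + m = k + m + 1 by ring,
      show (-((m + 1 : ℕ) : ℝ) + 1) = -m by push_cast; ring,
      show (-1 : ℝ) ^ (k + m + 1) / 2 ^ (m + 1) = (1 / 2) * (-((-1) ^ (k + m) / 2 ^ m)) by ring,
      show (-1 : ℝ) ^ (k + m + 1) / 2 ^ m = -((-1) ^ (k + m) / 2 ^ m) by ring]
    simp only [Polynomial.C_mul, Polynomial.C_neg, Polynomial.sub_comp]
    ring
  rw [polyP_spec, h, ← polyP_spec, ← polyP_spec]
  simp only [Polynomial.derivative_mul, Polynomial.derivative_C, Polynomial.derivative_add]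
  ring

theorem derivative_polyP_succ (k m : ℕ) :
    Polynomial.derivative (polyP k (m + 1)) = polyP k m := by
  apply eq_of_sub_derivative_eq
  rw [polyP_spec, ← Polynomial.derivative_sub, polyP_spec, integrandP, integrandP, ← add_assoc,
    Polynomial.derivative_mul, Polynomial.derivative_comp, derivative_lagPoly_succ,
    show (-((m + 1 : ℕ) : ℝ) + 1) = -m by push_cast; ring,
    show (-1 : ℝ) ^ (k + m + 1) / 2 ^ (m + 1) = (-1 / 2) * ((-1) ^ (k + m) / 2 ^ m) by ring,
    Polynomial.C_mul, show (-1 / 2 : ℝ) = -(1 / 2) by ring, Polynomial.C_neg]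
  have : (Polynomial.C (1 / 2 : ℝ)) * 2 = 1 := by
    rw [show (2 : Polynomial ℝ) = Polynomial.C 2 from rfl, ← Polynomial.C_mul]
    norm_num
  simp only [Polynomial.derivative_C, Polynomial.derivative_mul, Polynomial.derivative_X,
    Polynomial.neg_comp, Polynomial.derivative_ofNat, Polynomial.derivative_neg]
  linear_combination (Polynomial.C ((-1) ^ (k + m) / 2 ^ m) *
    (lagPoly (k + m) (-(m : ℝ))).comp (2 * Polynomial.X)) * this

/-- For k = 0 the upper argument m + β of the binomials is 0, so only the top monomial survives. -/
theorem integrandP_zero_left (m : ℕ) :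
    integrandP 0 m = Polynomial.monomial m (1 / (m.factorial : ℝ)) := by
  have : lagPoly m (-m) = Polynomial.C ((-1) ^ m / (m.factorial : ℝ)) * Polynomial.X ^ m := by
    ext l
    rw [coeff_lagPoly, add_neg_cancel, Ring.choose_zero_ite, Polynomial.coeff_C_mul_X_pow]
    rcases lt_trichotomy l m with h | h | h
    · rw [if_pos h.le, if_neg (by omega), if_neg (by omega), zero_mul]
    · subst h
      simp
    · rw [if_neg (by omega), if_neg (by omega)]
  rw [integrandP, zero_add, this, ← Polynomial.C_mul_X_pow_eq_monomial, Polynomial.mul_comp,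
    Polynomial.C_comp, Polynomial.X_pow_comp, mul_pow, ← mul_assoc, ← mul_assoc,
    show (2 : Polynomial ℝ) = Polynomial.C 2 from rfl, ← Polynomial.C_mul, ← Polynomial.C_pow,
    ← Polynomial.C_mul]
  congr 2
  have h1 : (-1 : ℝ) ^ m * (-1) ^ m = 1 := by rw [← mul_pow]; simp
  field_simp
  linear_combination h1

theorem polyP_zero_left (m : ℕ) :
    polyP 0 m = ∑ j ∈ Finset.range (m + 1), Polynomial.monomial j (1 / (j.factorial : ℝ)) := by
  apply eq_of_sub_derivative_eq
  rw [polyP_spec, integrandP_zero_left, Finset.sum_range_succ, Polynomial.derivative_add, Polynomial.derivative_sum]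
  cases m with
  | zero => simp
  | succ m =>
    rw [Finset.sum_range_succ' (fun j => Polynomial.derivative _)]
    have : ∀ j : ℕ, Polynomial.derivative (Polynomial.monomial (j + 1)
        (1 / ((j + 1).factorial : ℝ))) = Polynomial.monomial j (1 / (j.factorial : ℝ)) := by
      intro j
      rw [Polynomial.derivative_monomial, Nat.add_sub_cancel, Nat.factorial_succ]
      congr 1
      push_cast
      field_simp
    simp only [this]
    rw [Finset.sum_range_succ (fun j => Polynomial.monomial j (1 / (j.factorial : ℝ)))]
    simp

theorem eval_zero_polyP (k m : ℕ) : (polyP k m).eval 0 = 1 := by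
  induction k generalizing m with
  | zero =>
    rw [polyP_zero_left, Polynomial.eval_finsetSum, Finset.sum_range_succ']
    simp [Polynomial.eval_monomial]
  | succ k ih =>
    have h := congrArg (Polynomial.eval 0) (polyP_succ_right k m)
    rw [ih, Polynomial.eval_mul, Polynomial.eval_add, ih, Polynomial.eval_C] at h
    linarith

/-- Differentiating the recurrence and using P_{k;2}' = P_{k;1} gives P_{k+1;1}' = P_{k;1}' +
2(P_{k;1} - P_{k;1}'). The bracket is the integrand (-1)^k L_k(2a), and the increments add up. -/
theorem derivative_polyP_zero_eval (k : ℕ) (a : ℝ) :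
    (Polynomial.derivative (polyP (k + 1) 0)).eval a = 2 * altLagSum (2 * a) k := by
  have step : ∀ k, Polynomial.derivative (polyP (k + 1) 0) =
      Polynomial.derivative (polyP k 0) + 2 * integrandP k 0 := by
    intro k
    have h := congrArg Polynomial.derivative (polyP_succ_right k 0)
    rw [derivative_polyP_succ, Polynomial.derivative_mul, Polynomial.derivative_C,
      Polynomial.derivative_add] at h
    have : (Polynomial.C (1 / 2 : ℝ)) * 2 = 1 := by
      rw [show (2 : Polynomial ℝ) = Polynomial.C 2 from rfl, ← Polynomial.C_mul]
      norm_num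
    rw [← polyP_spec]
    linear_combination (-2) * h - (Polynomial.derivative (polyP k 0) +
      Polynomial.derivative (polyP (k + 1) 0)) * this
  have hq : ∀ k, (integrandP k 0).eval a = (-1) ^ k * (lagPoly k 0).eval (2 * a) := by
    intro k
    simp [integrandP, Polynomial.eval_comp]
  induction k with
  | zero =>
    rw [step, polyP_zero_left, Polynomial.eval_add, Polynomial.eval_mul, hq]
    simp [altLagSum]
  | succ k ih =>
    rw [step, Polynomial.eval_add, ih, Polynomial.eval_mul, hq, altLagSum, altLagSum,
      Finset.sum_range_succ (n := k + 1)]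
    simp
    ring

/-- The difference vanishes at 0. Its derivative is the same difference one dimension lower, or, at
the bottom, zero or an alternating Laguerre sum. -/
theorem polyP_zero_le (k m : ℕ) {a : ℝ} (ha : 0 ≤ a) :
    (polyP 0 m).eval a ≤ (polyP k m).eval a := by
  have key : ∀ p : Polynomial ℝ, p.eval 0 = 0 →
      (∀ x, 0 ≤ x → 0 ≤ (Polynomial.derivative p).eval x) → ∀ x, 0 ≤ x → 0 ≤ p.eval x := by
    intro p h0 hp x hx
    have : MonotoneOn (fun x => p.eval x) (Set.Ici 0) := by
      refine monotoneOn_of_deriv_nonneg (convex_Ici 0) p.continuous.continuousOn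
        p.differentiable.differentiableOn fun y hy => ?_
      rw [Polynomial.deriv]
      exact hp y (interior_subset hy)
    have := this (Set.self_mem_Ici) hx hx
    simpa [h0] using this
  rw [← sub_nonneg, ← Polynomial.eval_sub]
  induction m generalizing a with
  | zero =>
    refine key _ (by simp [eval_zero_polyP]) (fun x hx => ?_) a ha
    cases k with
    | zero => simp
    | succ k =>
      rw [Polynomial.derivative_sub, Polynomial.eval_sub, derivative_polyP_zero_eval,
        polyP_zero_left]
      simpa using altLagSum_nonneg (by linarith) k
  | succ m ih =>
    refine key _ (by simp [eval_zero_polyP]) (fun x hx => ?_) a ha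
    rw [Polynomial.derivative_sub, derivative_polyP_succ, derivative_polyP_succ]
    exact ih hx

theorem upperGamma_div_Gamma (m : ℕ) (a : ℝ) :
    upperGamma (m + 1 : ℕ) a / Real.Gamma (m + 1 : ℕ) = Real.exp (-a) * (polyP 0 m).eval a := by
  rw [← integral_exp_neg_mul_eval, polyP_spec, integrandP_zero_left,
    upperGamma, ← integral_const_mul]
  have e : (Set.Ioi a) = (fun t => t + a) '' Set.Ioi 0 := by simp
  rw [e, (measurePreserving_add_right volume a).setIntegral_image_emb
    (measurableEmbedding_addRight a), div_eq_inv_mul, ← integral_const_mul]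
  refine setIntegral_congr_fun measurableSet_Ioi fun t _ => ?_
  simp only [Polynomial.eval_monomial]
  rw [show ((m + 1 : ℕ) : ℝ) = (m : ℝ) + 1 by push_cast; ring, Real.Gamma_nat_eq_factorial,
    add_sub_cancel_right, Real.rpow_natCast, neg_add, Real.exp_add]
  ring

/-! ### Recovering the mass of a sublevel set from a characteristic function -/

/-- `sin(aτ)/(πτ)`, the Fourier transform of the indicator function of `[-a, a]`. -/
def sincKer (a τ : ℝ) : ℂ := ((Real.sin (a * τ) / (Real.pi * τ) : ℝ) : ℂ)

theorem measurable_sincKer (a : ℝ) : Measurable (sincKer a) := by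
  unfold sincKer
  fun_prop

theorem norm_sincKer_le (a τ : ℝ) : ‖sincKer a τ‖ ≤ |a| / Real.pi := by
  rw [sincKer, Complex.norm_real, Real.norm_eq_abs, abs_div, abs_mul, abs_of_pos Real.pi_pos]
  rcases eq_or_ne τ 0 with rfl | h
  · simp
    positivity
  · rw [div_le_div_iff₀ (by positivity) Real.pi_pos]
    have : |Real.sin (a * τ)| ≤ |a| * |τ| := by
      rw [← abs_mul]
      exact Real.abs_sin_le_abs
    nlinarith [Real.pi_pos]

/-- The kernel alone decays only like 1/|τ|; one factor (1-iτ)^{-1}, available since n ≥ 1, makes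
every integral below absolutely convergent. -/
theorem norm_sincKer_le_of_sqrt (a τ : ℝ) :
    ‖sincKer a τ‖ * (√(1 + τ ^ 2))⁻¹ ≤ (|a| + 1) / Real.pi * (1 + τ ^ 2)⁻¹ := by
  have h0 : 0 < 1 + τ ^ 2 := by positivity
  have hs : 0 < √(1 + τ ^ 2) := Real.sqrt_pos.2 h0
  have h1 : √(1 + τ ^ 2) ≤ 1 + |τ| := by
    rw [Real.sqrt_le_left (by positivity)]
    nlinarith [abs_nonneg τ, sq_abs τ]
  have h2 : ‖sincKer a τ‖ * |τ| ≤ 1 / Real.pi := by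
    rw [sincKer, Complex.norm_real, Real.norm_eq_abs, abs_div, abs_mul, abs_of_pos Real.pi_pos]
    rcases eq_or_ne τ 0 with rfl | h
    · simp
      positivity
    · have : 0 < |τ| := abs_pos.2 h
      have := Real.abs_sin_le_one (a * τ)
      field_simp
      exact this
  have h3 : ‖sincKer a τ‖ * √(1 + τ ^ 2) ≤ (|a| + 1) / Real.pi := by
    calc _ ≤ ‖sincKer a τ‖ * (1 + |τ|) := by gcongr
      _ = ‖sincKer a τ‖ + ‖sincKer a τ‖ * |τ| := by ring
      _ ≤ |a| / Real.pi + 1 / Real.pi := add_le_add (norm_sincKer_le a τ) h2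
      _ = _ := by ring
  calc ‖sincKer a τ‖ * (√(1 + τ ^ 2))⁻¹
      = ‖sincKer a τ‖ * √(1 + τ ^ 2) * (1 + τ ^ 2)⁻¹ := by
        nth_rewrite 3 [← Real.sq_sqrt h0.le]
        field_simp
    _ ≤ _ := by gcongr

theorem sincKer_eq_integral (a : ℝ) (ha : 0 ≤ a) {τ : ℝ} (hτ : τ ≠ 0) :
    sincKer a τ = (1 / (2 * Real.pi) : ℂ) *
      ∫ s in Set.Icc (-a) a, Complex.exp (-(Complex.I * τ) * s) := by
  have hc : -(Complex.I * τ) ≠ 0 := by simp [hτ]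
  have hτ' : (τ : ℂ) ≠ 0 := by exact_mod_cast hτ
  have hp : (Real.pi : ℂ) ≠ 0 := by exact_mod_cast Real.pi_ne_zero
  rw [integral_Icc_eq_integral_Ioc, ← intervalIntegral.integral_of_le (by linarith),
    integral_exp_mul_complex hc, sincKer]
  push_cast
  rw [Complex.sin]
  field_simp
  rw [Complex.I_sq]
  ring_nf

-- The kernel is the Fourier transform of the indicator of [-a, a], so a Gaussian cutoff in τ
-- mollifies that indicator. The cutoff (4π²c)⁻¹ and the `finrank` exponent match the mollifier of
-- `Real.tendsto_integral_gaussian_smul'`.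
open Module in
theorem integral_gaussian_mul_sincKer (a c r : ℝ) (ha : 0 ≤ a) (hc : 0 < c) :
    ∫ τ : ℝ, Complex.exp (-(4 * Real.pi ^ 2 * c : ℝ)⁻¹ * τ ^ 2) *
      (sincKer a τ * Complex.exp (Complex.I * τ * r)) =
    ∫ w : ℝ, ((Real.pi * c : ℂ) ^ (finrank ℝ ℝ / 2 : ℂ) *
      Complex.exp (-Real.pi ^ 2 * c * ‖r - w‖ ^ 2)) • (Set.Icc (-a) a).indicator (1 : ℝ → ℂ) w := by
  set b : ℝ := (4 * Real.pi ^ 2 * c)⁻¹ with hb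
  have hb0 : 0 < b := by positivity
  have hp : (Real.pi : ℂ) ≠ 0 := by exact_mod_cast Real.pi_ne_zero
  have hint : Integrable (Function.uncurry fun (τ s : ℝ) =>
      (1 / (2 * Real.pi) : ℂ) * (Complex.exp (-b * τ ^ 2) * Complex.exp (Complex.I * τ * (r - s))))
      (volume.prod (volume.restrict (Set.Icc (-a) a))) := by
    have h1 : Integrable (fun τ : ℝ => Real.exp (-b * τ ^ 2)) := integrable_exp_neg_mul_sq hb0
    have h2 : Integrable (fun _ : ℝ => (1 / (2 * Real.pi) : ℝ))
      (volume.restrict (Set.Icc (-a) a)) := integrable_const _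
    refine (h1.mul_prod h2).mono' (by fun_prop) (Filter.Eventually.of_forall fun p => ?_)
    have e1 : Complex.I * (p.1 : ℂ) * (r - p.2) = ((p.1 * (r - p.2) : ℝ) : ℂ) * Complex.I := by
      push_cast
      ring
    have e2 : (-(b : ℂ) * (p.1 : ℂ) ^ 2) = ((-b * p.1 ^ 2 : ℝ) : ℂ) := by push_cast; ring
    simp only [Function.uncurry, norm_mul, e1, Complex.norm_exp_ofReal_mul_I, mul_one, e2,
      Complex.norm_exp_ofReal]
    rw [mul_comm]
    simp [abs_of_pos Real.pi_pos]
  have hleft : ∀ᵐ τ : ℝ, Complex.exp (-(b : ℂ) * τ ^ 2) *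
      (sincKer a τ * Complex.exp (Complex.I * τ * r)) = ∫ s in Set.Icc (-a) a,
        (1 / (2 * Real.pi) : ℂ) *
          (Complex.exp (-b * τ ^ 2) * Complex.exp (Complex.I * τ * (r - s))) := by
    have : ∀ᵐ τ : ℝ, τ ≠ 0 := by simp [ae_iff]
    filter_upwards [this] with τ hτ
    rw [sincKer_eq_integral a ha hτ, ← integral_const_mul, ← integral_mul_const,
      ← integral_const_mul]
    refine integral_congr_ae (Filter.Eventually.of_forall fun s => ?_)
    simp only
    rw [show Complex.I * (τ : ℂ) * (r - s) = -(Complex.I * τ) * s + Complex.I * τ * r by ring,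
      Complex.exp_add]
    ring
  rw [integral_congr_ae hleft, integral_integral_swap hint]
  have hright : ∀ w : ℝ, ((Real.pi * c : ℂ) ^ (finrank ℝ ℝ / 2 : ℂ) *
      Complex.exp (-Real.pi ^ 2 * c * ‖r - w‖ ^ 2)) • (Set.Icc (-a) a).indicator (1 : ℝ → ℂ) w =
      (Set.Icc (-a) a).indicator (fun w => (Real.pi * c : ℂ) ^ (1 / 2 : ℂ) *
        Complex.exp (-Real.pi ^ 2 * c * (r - w) ^ 2)) w := by
    intro w
    by_cases hw : w ∈ Set.Icc (-a) a
    · rw [Set.indicator_of_mem hw, Set.indicator_of_mem hw]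
      have : (((‖r - w‖ : ℝ) : ℂ)) ^ 2 = (r - w) ^ 2 := by
        rw [Real.norm_eq_abs]
        exact_mod_cast sq_abs (r - w)
      rw [this]
      simp
    · rw [Set.indicator_of_notMem hw, Set.indicator_of_notMem hw, smul_zero]
  simp only [hright]
  rw [integral_indicator measurableSet_Icc]
  refine integral_congr_ae (Filter.Eventually.of_forall fun s => ?_)
  simp only
  rw [integral_const_mul]
  have hg := fourierIntegral_gaussian (b := (b : ℂ)) (by simpa using hb0) ((r : ℂ) - s)
  have : ∀ τ : ℝ, Complex.exp (-(b : ℂ) * τ ^ 2) * Complex.exp (Complex.I * τ * (r - s)) =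
      Complex.exp (Complex.I * (r - s) * τ) * Complex.exp (-(b : ℂ) * τ ^ 2) := by
    intro τ
    rw [mul_comm]
    congr 2
    ring
  simp only [this]
  rw [hg, ← mul_assoc]
  congr 1
  · have e1 : (Real.pi / b : ℂ) = ((4 * Real.pi ^ 2 * (Real.pi * c) : ℝ) : ℂ) := by
      rw [hb]
      push_cast
      field_simp
    have e2 : (Real.pi * c : ℂ) = ((Real.pi * c : ℝ) : ℂ) := by push_cast; rfl
    have e3 : (1 / 2 : ℂ) = ((1 / 2 : ℝ) : ℂ) := by push_cast; rfl
    rw [e1, e2, e3, ← Complex.ofReal_cpow (by positivity), ← Complex.ofReal_cpow (by positivity),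
      ← Real.sqrt_eq_rpow, ← Real.sqrt_eq_rpow, Real.sqrt_mul (by positivity),
      show 4 * Real.pi ^ 2 = (2 * Real.pi) ^ 2 by ring, Real.sqrt_sq (by positivity)]
    push_cast
    field_simp
  · congr 1
    rw [hb]
    push_cast
    have : (c : ℂ) ≠ 0 := by exact_mod_cast hc.ne'
    field_simp

open Module in
theorem norm_integral_gaussian_indicator_le (a c r : ℝ) (hc : 0 < c) :
    ‖∫ w : ℝ, ((Real.pi * c : ℂ) ^ (finrank ℝ ℝ / 2 : ℂ) *
      Complex.exp (-Real.pi ^ 2 * c * ‖r - w‖ ^ 2)) •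
        (Set.Icc (-a) a).indicator (1 : ℝ → ℂ) w‖ ≤ 1 := by
  have hb : 0 < Real.pi ^ 2 * c := by positivity
  have h1 : Integrable (fun w : ℝ => √(Real.pi * c) * Real.exp (-(Real.pi ^ 2 * c) * (r - w) ^ 2)) :=
    ((integrable_exp_neg_mul_sq hb).comp_sub_left r).const_mul _
  refine (norm_integral_le_of_norm_le h1 (Filter.Eventually.of_forall fun w => ?_)).trans_eq ?_
  · have e2 : (Real.pi * c : ℂ) = ((Real.pi * c : ℝ) : ℂ) := by push_cast; rfl
    have e3 : ((finrank ℝ ℝ : ℂ) / 2 : ℂ) = ((1 / 2 : ℝ) : ℂ) := by simp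
    have e4 : (-(Real.pi : ℂ) ^ 2 * c * (‖r - w‖ : ℝ) ^ 2) =
        ((-(Real.pi ^ 2 * c) * (r - w) ^ 2 : ℝ) : ℂ) := by
      rw [Real.norm_eq_abs, ← sq_abs (r - w)]
      push_cast
      ring
    rw [norm_smul, norm_mul, e4, Complex.norm_exp_ofReal, e2, e3,
      ← Complex.ofReal_cpow (by positivity), ← Real.sqrt_eq_rpow, Complex.norm_real,
      Real.norm_of_nonneg (Real.sqrt_nonneg _)]
    have : ‖(Set.Icc (-a) a).indicator (1 : ℝ → ℂ) w‖ ≤ 1 := by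
      by_cases hw : w ∈ Set.Icc (-a) a
      · rw [Set.indicator_of_mem hw]; simp
      · rw [Set.indicator_of_notMem hw]; simp
    exact mul_le_of_le_one_right (by positivity) this
  · rw [integral_const_mul,
      integral_sub_left_eq_self (fun w : ℝ => Real.exp (-(Real.pi ^ 2 * c) * w ^ 2)),
      integral_gaussian, ← Real.sqrt_mul (by positivity)]
    have : Real.pi * c * (Real.pi / (Real.pi ^ 2 * c)) = 1 := by
      field_simp
    rw [this, Real.sqrt_one]

open Filter Topology in
/-- If `φ(τ) = ∫ e^{iτρ} f` then `∫_{|ρ| ≤ a} f = ∫ sin(aτ)/(πτ) φ(τ) dτ`. -/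
theorem setIntegral_abs_le_eq_integral_sincKer {X : Type*} [MeasurableSpace X] {μ : Measure X}
    [SFinite μ] {f : X → ℂ} (hf : Integrable f μ) {ρ : X → ℝ} (hρ : Measurable ρ) {a : ℝ}
    (ha : 0 ≤ a) (hnull : μ {x | |ρ x| = a} = 0) {φ : ℝ → ℂ}
    (hφ : ∀ τ : ℝ, φ τ = ∫ x, Complex.exp (Complex.I * τ * ρ x) * f x ∂μ)
    (hint : Integrable fun τ => sincKer a τ * φ τ) :
    ∫ x in {x | |ρ x| ≤ a}, f x ∂μ = ∫ τ, sincKer a τ * φ τ := by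
  -- One regularised integral has two limits as c → ∞: `lim1` removes the Gaussian cutoff in τ,
  -- `lim2` lets the mollified indicator converge under the integral over `X`. Fubini (`fub`)
  -- identifies the two sides.
  have lim1 := (Real.tendsto_integral_cexp_sq_smul hint).comp
    (tendsto_id.const_mul_atTop (show (0 : ℝ) < 4 * Real.pi ^ 2 by positivity))
  have hset : MeasurableSet {x | |ρ x| ≤ a} := measurableSet_le hρ.abs measurable_const
  set K : ℝ → ℝ → ℂ := fun c r => ∫ w : ℝ, ((Real.pi * c : ℂ) ^ (Module.finrank ℝ ℝ / 2 : ℂ) *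
      Complex.exp (-Real.pi ^ 2 * c * ‖r - w‖ ^ 2)) •
        (Set.Icc (-a) a).indicator (1 : ℝ → ℂ) w with hK
  have hKmeas : ∀ c, Measurable (K c) := by
    intro c
    refine StronglyMeasurable.measurable ?_
    refine StronglyMeasurable.integral_prod_right (f := fun r w : ℝ =>
      ((Real.pi * c : ℂ) ^ (Module.finrank ℝ ℝ / 2 : ℂ) *
      Complex.exp (-Real.pi ^ 2 * c * ‖r - w‖ ^ 2)) •
        (Set.Icc (-a) a).indicator (1 : ℝ → ℂ) w) ?_
    refine Measurable.stronglyMeasurable ?_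
    refine Measurable.smul (f := fun p : ℝ × ℝ => (Real.pi * c : ℂ) ^
      (Module.finrank ℝ ℝ / 2 : ℂ) * Complex.exp (-Real.pi ^ 2 * c * ‖p.1 - p.2‖ ^ 2))
      (g := fun p => (Set.Icc (-a) a).indicator (1 : ℝ → ℂ) p.2) (by fun_prop) ?_
    exact (measurable_one.indicator measurableSet_Icc).comp measurable_snd
  have fub : ∀ᶠ c : ℝ in atTop, ∫ x, K c (ρ x) * f x ∂μ =
      ∫ τ : ℝ, Complex.exp (-(((4 * Real.pi ^ 2 * c)⁻¹ : ℝ) : ℂ) * ‖τ‖ ^ 2) •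
        (sincKer a τ * φ τ) := by
    filter_upwards [eventually_gt_atTop 0] with c hc
    set b : ℝ := (4 * Real.pi ^ 2 * c)⁻¹ with hb
    have hb0 : 0 < b := by positivity
    have hsq : ∀ τ : ℝ, (((‖τ‖ : ℝ) : ℂ)) ^ 2 = (τ : ℂ) ^ 2 := fun τ => by
      rw [Real.norm_eq_abs]
      exact_mod_cast sq_abs τ
    have hI : Integrable (Function.uncurry fun (τ : ℝ) (x : X) =>
        Complex.exp (-(b : ℂ) * τ ^ 2) * (sincKer a τ * Complex.exp (Complex.I * τ * ρ x)) * f x)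
        (volume.prod μ) := by
      have h1 : Integrable (fun τ : ℝ => Real.exp (-b * τ ^ 2) * (|a| / Real.pi)) :=
        (integrable_exp_neg_mul_sq hb0).mul_const _
      refine (h1.mul_prod hf.norm).mono' ?_ (Eventually.of_forall fun p => ?_)
      · refine AEStronglyMeasurable.mul ?_ hf.1.comp_snd
        have := measurable_sincKer a
        exact Measurable.aestronglyMeasurable (by fun_prop)
      · have e1 : Complex.I * (p.1 : ℂ) * ρ p.2 = ((p.1 * ρ p.2 : ℝ) : ℂ) * Complex.I := by
          push_cast
          ring
        have e2 : (-(b : ℂ) * (p.1 : ℂ) ^ 2) = ((-b * p.1 ^ 2 : ℝ) : ℂ) := by push_cast; ring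
        simp only [Function.uncurry, norm_mul, e1, Complex.norm_exp_ofReal_mul_I, mul_one, e2,
          Complex.norm_exp_ofReal]
        gcongr
        exact norm_sincKer_le a p.1
    have e : ∀ x, K c (ρ x) * f x = ∫ τ : ℝ, Complex.exp (-(b : ℂ) * τ ^ 2) *
        (sincKer a τ * Complex.exp (Complex.I * τ * ρ x)) * f x := by
      intro x
      rw [integral_mul_const, hK]
      simp only
      rw [← integral_gaussian_mul_sincKer a c (ρ x) ha hc, ← hb]
    simp only [e]
    rw [integral_integral_swap (f := fun (x : X) (τ : ℝ) => Complex.exp (-(b : ℂ) * τ ^ 2) *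
        (sincKer a τ * Complex.exp (Complex.I * τ * ρ x)) * f x) hI.swap]
    refine integral_congr_ae (Eventually.of_forall fun τ => ?_)
    simp only [hφ, smul_eq_mul, hsq]
    rw [← integral_const_mul, ← integral_const_mul]
    refine integral_congr_ae (Eventually.of_forall fun x => ?_)
    simp only
    ring
  have lim2 : Tendsto (fun c => ∫ x, K c (ρ x) * f x ∂μ) atTop
      (𝓝 (∫ x, (Set.Icc (-a) a).indicator (1 : ℝ → ℂ) (ρ x) * f x ∂μ)) := by
    refine tendsto_integral_filter_of_dominated_convergence (fun x => ‖f x‖) ?_ ?_ hf.norm ?_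
    · exact Eventually.of_forall fun c =>
        ((hKmeas c).comp hρ).aestronglyMeasurable.mul hf.1
    · filter_upwards [eventually_gt_atTop 0] with c hc
      refine Eventually.of_forall fun x => ?_
      rw [norm_mul]
      exact mul_le_of_le_one_left (norm_nonneg _)
        (norm_integral_gaussian_indicator_le a c (ρ x) hc)
    -- The mollified indicator recovers the indicator only off its jumps ±a, hence the null-set
    -- hypothesis.
    · have hne : ∀ᵐ x ∂μ, |ρ x| ≠ a := by
        rw [ae_iff]
        simpa using hnull
      filter_upwards [hne] with x hx
      refine Tendsto.mul_const _ ?_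
      refine Real.tendsto_integral_gaussian_smul' ?_ ?_
      · exact (integrable_indicator_iff measurableSet_Icc).2 (integrable_const _)
      · rcases lt_or_gt_of_ne hx with h | h
        · have : (Set.Icc (-a) a) ∈ 𝓝 (ρ x) := Icc_mem_nhds (abs_lt.1 h).1 (abs_lt.1 h).2
          refine (continuousAt_const (y := (1 : ℂ))).congr ?_
          filter_upwards [this] with y hy
          rw [Set.indicator_of_mem hy]
          rfl
        · have : (Set.Icc (-a) a)ᶜ ∈ 𝓝 (ρ x) := by
            refine isClosed_Icc.isOpen_compl.mem_nhds fun hmem => ?_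
            exact absurd (abs_le.2 hmem) (not_le.2 h)
          refine (continuousAt_const (y := (0 : ℂ))).congr ?_
          filter_upwards [this] with y hy
          rw [Set.indicator_of_notMem hy]
  have := tendsto_nhds_unique (lim2.congr' fub) lim1
  rw [← this, ← integral_indicator hset]
  refine integral_congr_ae (Eventually.of_forall fun x => ?_)
  simp only [Set.indicator, Set.mem_ofPred_eq, Set.mem_Icc, abs_le, Pi.one_apply]
  split_ifs <;> simp

/-! ### The coefficients `F_{k;n}` -/

theorem one_sub_I_mul_ne_zero (τ : ℝ) : 1 - Complex.I * (τ : ℂ) ≠ 0 := by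
  intro h
  simpa using congrArg Complex.re h

theorem norm_one_add_I_mul (τ : ℝ) : ‖1 + Complex.I * (τ : ℂ)‖ = √(1 + τ ^ 2) := by
  rw [Complex.norm_def, Complex.normSq_apply]
  simp
  ring_nf

theorem norm_one_sub_I_mul (τ : ℝ) : ‖1 - Complex.I * (τ : ℂ)‖ = √(1 + τ ^ 2) := by
  rw [Complex.norm_def, Complex.normSq_apply]
  simp
  ring_nf

theorem sqrt_one_add_sq_pos (τ : ℝ) : 0 < √(1 + τ ^ 2) := Real.sqrt_pos.2 (by positivity)

theorem one_le_sqrt_one_add_sq (τ : ℝ) : 1 ≤ √(1 + τ ^ 2) := by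
  rw [Real.one_le_sqrt]
  nlinarith [sq_nonneg τ]

theorem norm_inv_one_sub_I_mul_pow_le (m : ℕ) (τ : ℝ) :
    ‖((1 - Complex.I * (τ : ℂ)) ^ (m + 1))⁻¹‖ ≤ (√(1 + τ ^ 2))⁻¹ := by
  rw [norm_inv, norm_pow, norm_one_sub_I_mul]
  exact inv_anti₀ (sqrt_one_add_sq_pos τ)
    (le_self_pow₀ (one_le_sqrt_one_add_sq τ) (Nat.succ_ne_zero m))

theorem norm_coeffIntegrand_le (k m : ℕ) (a τ : ℝ) :
    ‖coeffIntegrand k (m + 1) a τ‖ ≤ (|a| + 1) / Real.pi * (1 + τ ^ 2)⁻¹ := by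
  refine le_trans ?_ (norm_sincKer_le_of_sqrt a τ)
  rw [coeffIntegrand, norm_mul]
  refine mul_le_mul_of_nonneg_left ?_ (norm_nonneg _)
  rw [add_comm k, pow_add, mul_comm (_ ^ _) (_ ^ k), ← div_div, ← div_pow, div_eq_mul_inv, norm_mul,
    norm_pow, norm_div, norm_one_add_I_mul, norm_one_sub_I_mul,
    div_self (sqrt_one_add_sq_pos τ).ne', one_pow, one_mul]
  exact norm_inv_one_sub_I_mul_pow_le m τ

theorem integrable_coeffBound (a : ℝ) :
    Integrable fun τ : ℝ => (|a| + 1) / Real.pi * (1 + τ ^ 2)⁻¹ :=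
  integrable_inv_one_add_sq.const_mul _

theorem integrable_coeffIntegrand (k m : ℕ) (a : ℝ) :
    Integrable (coeffIntegrand k (m + 1) a) := by
  refine (integrable_coeffBound a).mono' ?_
    (Filter.Eventually.of_forall (norm_coeffIntegrand_le k m a))
  unfold coeffIntegrand
  exact Measurable.aestronglyMeasurable (by fun_prop)

theorem norm_ballCoeff_le (m : ℕ) (a : ℝ) :
    ∃ C, ∀ k, ‖ballCoeff k (m + 1) a‖ ≤ C :=
  ⟨_, fun k => norm_integral_le_of_norm_le (integrable_coeffBound a)
    (Filter.Eventually.of_forall (norm_coeffIntegrand_le k m a))⟩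

/-- From (1+iτ)/(1-iτ) = 2/(1-iτ) - 1. -/
theorem ballCoeff_succ_left (k m : ℕ) (a : ℝ) :
    ballCoeff (k + 1) (m + 1) a = 2 * ballCoeff k (m + 1 + 1) a - ballCoeff k (m + 1) a := by
  unfold ballCoeff
  rw [← integral_const_mul, ← integral_sub ((integrable_coeffIntegrand k (m + 1) a).const_mul _)
    (integrable_coeffIntegrand k m a)]
  congr 1
  funext τ
  have := one_sub_I_mul_ne_zero τ
  have e1 : k + 1 + (m + 1) = k + m + 2 := by ring
  have e2 : k + (m + 1 + 1) = k + m + 2 := by ring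
  simp only [coeffIntegrand]
  rw [e1, e2, ← add_assoc]
  field_simp
  ring

theorem hasDerivAt_pow_mul_cexp (c : ℂ) (m : ℕ) (t : ℝ) :
    HasDerivAt (fun t : ℝ => (t : ℂ) ^ (m + 1) * Complex.exp (-c * t))
      (((m : ℂ) + 1) * ((t : ℂ) ^ m * Complex.exp (-c * t)) -
        c * ((t : ℂ) ^ (m + 1) * Complex.exp (-c * t))) t := by
  have h1 : HasDerivAt (fun t : ℝ => (t : ℂ)) 1 t := Complex.ofRealCLM.hasDerivAt
  have h2 := h1.pow (m + 1)
  have h3 := (h1.const_mul (-c)).cexp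
  convert! h2.mul h3 using 1
  push_cast
  simp
  ring

theorem integrableOn_pow_mul_cexp {c : ℂ} (hc : 0 < c.re) (m : ℕ) :
    IntegrableOn (fun t : ℝ => (t : ℂ) ^ m * Complex.exp (-c * t)) (Set.Ioi 0) := by
  have h := integrableOn_rpow_mul_exp_neg_mul_rpow (s := m) (p := 1)
    (by have : (0 : ℝ) ≤ m := m.cast_nonneg
        linarith) one_pos hc
  refine Integrable.mono' h (by fun_prop) ?_
  refine (ae_restrict_iff' measurableSet_Ioi).2 (Filter.Eventually.of_forall fun t ht => ?_)
  rw [norm_mul, norm_pow, Complex.norm_real, Real.norm_of_nonneg (le_of_lt ht), Complex.norm_exp]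
  simp

theorem integral_pow_mul_cexp {c : ℂ} (hc : 0 < c.re) (m : ℕ) :
    ∫ t in Set.Ioi (0 : ℝ), (t : ℂ) ^ m * Complex.exp (-c * t) = m.factorial / c ^ (m + 1) := by
  have hc0 : c ≠ 0 := by
    rintro rfl
    simp at hc
  induction m with
  | zero =>
    have := integral_exp_mul_complex_Ioi (a := -c) (by simpa using hc) 0
    simpa using this
  | succ m ih =>
    have h := integral_Ioi_of_hasDerivAt_of_tendsto' (a := 0) (m := 0)
      (fun t _ => hasDerivAt_pow_mul_cexp c m t)
      (((integrableOn_pow_mul_cexp hc m).const_mul _).sub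
        ((integrableOn_pow_mul_cexp hc (m + 1)).const_mul _)) ?_
    · rw [integral_sub ((integrableOn_pow_mul_cexp hc m).const_mul _)
        ((integrableOn_pow_mul_cexp hc (m + 1)).const_mul _), integral_const_mul,
        integral_const_mul, ih] at h
      simp only [Complex.ofReal_zero, ne_eq, Nat.succ_ne_zero, not_false_eq_true, zero_pow,
        zero_mul, sub_zero] at h
      have h' : c * ∫ t in Set.Ioi (0 : ℝ), (t : ℂ) ^ (m + 1) * Complex.exp (-c * t) =
          ((m : ℂ) + 1) * (m.factorial / c ^ (m + 1)) := by linear_combination -h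
      rw [eq_div_iff (by positivity), pow_succ c (m + 1), mul_comm (c ^ (m + 1)), ← mul_assoc,
        mul_comm _ c, h', Nat.factorial_succ]
      push_cast
      field_simp
    · rw [tendsto_zero_iff_norm_tendsto_zero]
      have h1 := Real.tendsto_pow_mul_exp_neg_atTop_nhds_zero (m + 1)
      have h2 := h1.comp (Filter.tendsto_id.const_mul_atTop hc)
      have h3 := h2.const_mul ((c.re ^ (m + 1))⁻¹)
      rw [mul_zero] at h3
      refine h3.congr' ?_
      filter_upwards [Filter.eventually_ge_atTop 0] with t ht
      rw [norm_mul, norm_pow, Complex.norm_real, Real.norm_of_nonneg ht, Complex.norm_exp]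
      simp [mul_pow]
      field_simp

/-- The function (1-iτ)^{-(m+1)} is the characteristic function of the Gamma density t^m e^{-t}/m!
on (0,∞), so inversion returns its mass on (0, a]. -/
theorem ballCoeff_zero_left (m : ℕ) {a : ℝ} (ha : 0 ≤ a) :
    ballCoeff 0 (m + 1) a = ((1 - Real.exp (-a) * (polyP 0 m).eval a : ℝ) : ℂ) := by
  have hf0 : (m.factorial : ℂ) ≠ 0 := by exact_mod_cast m.factorial_ne_zero
  set f : ℝ → ℂ := fun t => (t : ℂ) ^ m * Complex.exp (-1 * t) / m.factorial with hf
  have hfi : IntegrableOn f (Set.Ioi 0) := (integrableOn_pow_mul_cexp (by simp) m).div_const _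
  have hmain := setIntegral_abs_le_eq_integral_sincKer (μ := volume.restrict (Set.Ioi (0 : ℝ)))
    (f := f) hfi (ρ := fun t => t) measurable_id ha ?_
    (φ := fun τ => ((1 - Complex.I * τ) ^ (m + 1))⁻¹) ?_ ?_
  · have e1 : ballCoeff 0 (m + 1) a =
        ∫ τ : ℝ, sincKer a τ * ((1 - Complex.I * τ) ^ (m + 1))⁻¹ := by
      rw [ballCoeff]
      congr 1
      funext τ
      simp [coeffIntegrand, sincKer]
    rw [e1, ← hmain]
    have hset : MeasurableSet {t : ℝ | |t| ≤ a} := measurableSet_le measurable_id.abs measurable_const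
    rw [Measure.restrict_restrict hset]
    have e2 : {t : ℝ | |t| ≤ a} ∩ Set.Ioi 0 = Set.Ioc 0 a := by
      ext t
      simp only [Set.mem_inter_iff, Set.mem_ofPred_eq, Set.mem_Ioi, Set.mem_Ioc]
      constructor
      · rintro ⟨h1, h2⟩
        exact ⟨h2, (le_abs_self t).trans h1⟩
      · rintro ⟨h1, h2⟩
        exact ⟨by rwa [abs_of_pos h1], h1⟩
    rw [e2]
    have e3 : Set.Ioi (0 : ℝ) = Set.Ioc 0 a ∪ Set.Ioi a := (Set.Ioc_union_Ioi_eq_Ioi ha).symm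
    have hfi2 := hfi
    rw [e3] at hfi2
    have e4 : ∫ t in Set.Ioi (0 : ℝ), f t =
        (∫ t in Set.Ioc 0 a, f t) + ∫ t in Set.Ioi a, f t := by
      conv_lhs => rw [e3]
      exact setIntegral_union (Set.disjoint_left.2 fun t h1 h2 => absurd h1.2 (not_le.2 h2))
        measurableSet_Ioi hfi2.left_of_union hfi2.right_of_union
    have e5 : ∫ t in Set.Ioi (0 : ℝ), f t = 1 := by
      rw [hf, integral_div, integral_pow_mul_cexp (by simp)]
      simp [hf0]
    have e6 : ∫ t in Set.Ioi a, f t = ((Real.exp (-a) * (polyP 0 m).eval a : ℝ) : ℂ) := by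
      rw [← upperGamma_div_Gamma, upperGamma, ← integral_div, ← integral_complex_ofReal]
      refine setIntegral_congr_fun measurableSet_Ioi fun t _ => ?_
      simp only [hf]
      rw [show ((m + 1 : ℕ) : ℝ) = (m : ℝ) + 1 by push_cast; ring, Real.Gamma_nat_eq_factorial,
        add_sub_cancel_right, Real.rpow_natCast]
      push_cast
      simp
    rw [Complex.ofReal_sub, ← e6, Complex.ofReal_one, ← e5, e4]
    ring
  · refine le_antisymm ((Measure.restrict_le_self _).trans ?_) zero_le
    refine (measure_mono (t := {a, -a}) fun t ht => ?_).trans_eq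
      ((Set.toFinite _).measure_zero volume)
    rcases abs_choice t with h | h
    · left
      exact h ▸ ht
    · right
      have : -t = a := h ▸ ht
      simp [← this]
  · intro τ
    have h := integral_pow_mul_cexp (c := 1 - Complex.I * τ) (by simp) m
    have e : ∀ t : ℝ, Complex.exp (Complex.I * τ * t) * f t =
        ((t : ℂ) ^ m * Complex.exp (-(1 - Complex.I * τ) * t)) / m.factorial := by
      intro t
      rw [show -(1 - Complex.I * (τ : ℂ)) * t = Complex.I * τ * t + -1 * t by ring,
        Complex.exp_add, hf]
      ring
    simp only [e]
    rw [integral_div, h]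
    field_simp
  · refine (integrable_coeffIntegrand 0 m a).congr (Filter.Eventually.of_forall fun τ => ?_)
    simp [coeffIntegrand, sincKer]

theorem ballCoeff_eq (k m : ℕ) {a : ℝ} (ha : 0 ≤ a) :
    ballCoeff k (m + 1) a = ((1 - Real.exp (-a) * (polyP k m).eval a : ℝ) : ℂ) := by
  induction k generalizing m with
  | zero => exact ballCoeff_zero_left m ha
  | succ k ih =>
    have h := congrArg (Polynomial.eval a) (polyP_succ_right k m)
    rw [Polynomial.eval_mul, Polynomial.eval_add, Polynomial.eval_C] at h
    have h' : (polyP (k + 1) m).eval a = 2 * (polyP k (m + 1)).eval a - (polyP k m).eval a := by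
      linarith
    rw [ballCoeff_succ_left, ih, ih, h']
    push_cast
    ring

/-- The largest coefficient, `1 - Γ(n,a)/Γ(n)`. -/
theorem re_ballCoeff_le (k m : ℕ) {a : ℝ} (ha : 0 ≤ a) :
    (ballCoeff k (m + 1) a).re ≤ 1 - upperGamma (m + 1 : ℕ) a / Real.Gamma (m + 1 : ℕ) := by
  rw [ballCoeff_eq k m ha, Complex.ofReal_re, upperGamma_div_Gamma]
  have := mul_le_mul_of_nonneg_left (polyP_zero_le k m ha) (Real.exp_pos (-a)).le
  linarith

/-! ### One-dimensional Hermite functions -/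

/-- `He_k(2√π x) e^{-2πx²}`. -/
def hermiteGauss (k : ℕ) (x : ℝ) : ℝ :=
  Polynomial.aeval (2 * √Real.pi * x) (Polynomial.hermite k) * Real.exp (-(2 * Real.pi) * x ^ 2)

theorem two_mul_sqrt_pi_pos : 0 < 2 * √Real.pi := by
  have := Real.sqrt_pos.2 Real.pi_pos
  positivity

/-- By He_{k+1} = X He_k - He_k', the family is closed under differentiation; each integration by
parts then lowers k by one. -/
theorem hasDerivAt_hermiteGauss (k : ℕ) (x : ℝ) :
    HasDerivAt (hermiteGauss k) (-(2 * √Real.pi) * hermiteGauss (k + 1) x) x := by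
  have h1 : HasDerivAt (fun x : ℝ => 2 * √Real.pi * x) (2 * √Real.pi) x := by
    simpa using (hasDerivAt_id x).const_mul (2 * √Real.pi)
  have h2 := ((Polynomial.hermite k).hasDerivAt_aeval (2 * √Real.pi * x)).comp x h1
  have h3 : HasDerivAt (fun x : ℝ => Real.exp (-(2 * Real.pi) * x ^ 2))
      (Real.exp (-(2 * Real.pi) * x ^ 2) * (-(2 * Real.pi) * (2 * x))) x := by
    simpa using ((hasDerivAt_pow 2 x).const_mul (-(2 * Real.pi))).exp
  have h4 := h2.mul h3
  refine h4.congr_deriv ?_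
  have hs : √Real.pi * √Real.pi = Real.pi := Real.mul_self_sqrt Real.pi_pos.le
  simp only [hermiteGauss, Polynomial.hermite_succ, map_sub, map_mul, Polynomial.aeval_X,
    Function.comp_apply]
  linear_combination (4 * x * Real.exp (-(2 * Real.pi) * x ^ 2) *
    Polynomial.aeval (2 * √Real.pi * x) (Polynomial.hermite k)) * hs

theorem integrable_eval_mul_gauss (p : Polynomial ℝ) :
    Integrable (fun x : ℝ => p.eval x * Real.exp (-(2 * Real.pi) * x ^ 2)) := by
  induction p using Polynomial.induction_on' with
  | add p q hp hq =>
    simp only [Polynomial.eval_add, add_mul]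
    exact hp.add hq
  | monomial m c =>
    have h := integrable_rpow_mul_exp_neg_mul_sq (b := 2 * Real.pi) (by positivity)
      (s := (m : ℝ)) (by have : (0 : ℝ) ≤ m := m.cast_nonneg
                         linarith)
    refine (h.const_mul c).congr (Filter.Eventually.of_forall fun x => ?_)
    simp only [Polynomial.eval_monomial, Real.rpow_natCast]
    ring

/-- The polynomial `He_k(2√π X)`. -/
def scaledHermite (k : ℕ) : Polynomial ℝ :=
  ((Polynomial.hermite k).map (Int.castRingHom ℝ)).comp
    (Polynomial.C (2 * √Real.pi) * Polynomial.X)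

theorem eval_scaledHermite (k : ℕ) (x : ℝ) : (scaledHermite k).eval x =
    Polynomial.aeval (2 * √Real.pi * x) (Polynomial.hermite k) := by
  simp [scaledHermite, Polynomial.eval_comp, Polynomial.aeval_def, Polynomial.eval_map]

theorem hermiteGauss_eq (k : ℕ) (x : ℝ) :
    hermiteGauss k x = (scaledHermite k).eval x * Real.exp (-(2 * Real.pi) * x ^ 2) := by
  rw [hermiteGauss, eval_scaledHermite]

theorem integrable_hermiteGauss_mul_eval (k : ℕ) (p : Polynomial ℝ) :
    Integrable (fun x : ℝ => hermiteGauss k x * p.eval x) := by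
  refine (integrable_eval_mul_gauss (scaledHermite k * p)).congr
    (Filter.Eventually.of_forall fun x => ?_)
  simp only [hermiteGauss_eq, Polynomial.eval_mul]
  ring

theorem integral_hermiteGauss_succ_mul_eval (k : ℕ) (p : Polynomial ℝ) :
    ∫ x, hermiteGauss (k + 1) x * p.eval x =
      (2 * √Real.pi)⁻¹ * ∫ x, hermiteGauss k x * (Polynomial.derivative p).eval x := by
  have h := integral_mul_deriv_eq_deriv_mul_of_integrable (u := hermiteGauss k)
    (v := fun x => p.eval x) (fun x _ => hasDerivAt_hermiteGauss k x) (fun x _ => p.hasDerivAt x)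
    (integrable_hermiteGauss_mul_eval k _)
    (by
      refine ((integrable_hermiteGauss_mul_eval (k + 1) p).const_mul (-(2 * √Real.pi))).congr
        (Filter.Eventually.of_forall fun x => ?_)
      simp only [Pi.mul_apply]
      ring)
    (integrable_hermiteGauss_mul_eval k p)
  have hs := two_mul_sqrt_pi_pos
  rw [h]
  simp only [mul_assoc, neg_mul, integral_neg, neg_neg, integral_const_mul]
  field_simp

theorem integral_hermiteGauss_mul_eval (k : ℕ) (p : Polynomial ℝ) :
    ∫ x, hermiteGauss k x * p.eval x = (2 * √Real.pi)⁻¹ ^ k *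
      ∫ x, (Polynomial.derivative^[k] p).eval x * Real.exp (-(2 * Real.pi) * x ^ 2) := by
  induction k generalizing p with
  | zero => simp [hermiteGauss, mul_comm]
  | succ k ih =>
    rw [integral_hermiteGauss_succ_mul_eval, ih, Function.iterate_succ_apply]
    ring

/-- Integrating by parts k times differentiates a polynomial of degree j ≤ k: nothing remains if j <
k, and the constant j!(2√π)^j if j = k. -/
theorem integral_hermiteFun_mul_of_le {j k : ℕ} (hjk : j ≤ k) :
    ∫ x, hermiteFun k x * hermiteFun j x = if j = k then 1 else 0 := by
  have h1 : ∀ x, hermiteFun k x * hermiteFun j x =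
      (√2 / (√(k.factorial : ℝ) * √(j.factorial : ℝ))) *
        (hermiteGauss k x * (scaledHermite j).eval x) := by
    intro x
    have e1 : (2 : ℝ) ^ (1 / 4 : ℝ) * (2 : ℝ) ^ (1 / 4 : ℝ) = √2 := by
      rw [← Real.rpow_add two_pos, Real.sqrt_eq_rpow]
      norm_num
    have e2 : Real.exp (-(Real.pi * x ^ 2)) * Real.exp (-(Real.pi * x ^ 2)) =
        Real.exp (-(2 * Real.pi) * x ^ 2) := by
      rw [← Real.exp_add]
      ring_nf
    rw [hermiteFun_eq, hermiteFun_eq, hermiteGauss, eval_scaledHermite, ← e1, ← e2]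
    ring
  simp only [h1]
  rw [integral_const_mul, integral_hermiteGauss_mul_eval]
  have hs := two_mul_sqrt_pi_pos
  have hdeg : (scaledHermite j).natDegree = j := by
    rw [scaledHermite, Polynomial.natDegree_comp, Polynomial.natDegree_C_mul_X _ hs.ne', mul_one,
      (Polynomial.hermite_monic j).natDegree_map, Polynomial.natDegree_hermite]
  split_ifs with h
  · subst h
    have hlead : (scaledHermite j).coeff j = (2 * √Real.pi) ^ j := by
      rw [show (scaledHermite j).coeff j = (scaledHermite j).leadingCoeff by
        rw [Polynomial.leadingCoeff, hdeg], scaledHermite,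
        Polynomial.leadingCoeff_comp, ((Polynomial.hermite_monic j).map _).leadingCoeff, Polynomial.leadingCoeff_mul,
        Polynomial.leadingCoeff_C, Polynomial.leadingCoeff_X,
        (Polynomial.hermite_monic j).natDegree_map, Polynomial.natDegree_hermite]
      · simp
      · rw [Polynomial.natDegree_C_mul_X _ hs.ne']
        exact one_ne_zero
    have hD : Polynomial.derivative^[j] (scaledHermite j) =
        Polynomial.C ((j.factorial : ℝ) * (2 * √Real.pi) ^ j) := by
      have h0 : (Polynomial.derivative^[j] (scaledHermite j)).natDegree = 0 := by
        have := Polynomial.natDegree_iterate_derivative (scaledHermite j) j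
        omega
      rw [Polynomial.eq_C_of_natDegree_eq_zero h0, Polynomial.coeff_iterate_derivative, zero_add,
        Nat.descFactorial_self, hlead, nsmul_eq_mul]
    rw [hD]
    simp only [Polynomial.eval_C]
    rw [integral_const_mul, integral_gaussian]
    have e3 : Real.pi / (2 * Real.pi) = 1 / 2 := by field_simp
    have e4 : √(j.factorial : ℝ) * √(j.factorial : ℝ) = j.factorial :=
      Real.mul_self_sqrt (by positivity)
    rw [e3, e4, Real.sqrt_div zero_le_one, Real.sqrt_one, inv_pow]
    have : (j.factorial : ℝ) ≠ 0 := by positivity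
    field_simp
  · rw [Polynomial.iterate_derivative_eq_zero (by omega)]
    simp

theorem integral_hermiteFun_mul (j k : ℕ) :
    ∫ x, hermiteFun j x * hermiteFun k x = if j = k then 1 else 0 := by
  rcases le_total j k with h | h
  · rw [← integral_hermiteFun_mul_of_le h]
    simp only [mul_comm]
  · rw [integral_hermiteFun_mul_of_le h]
    simp only [eq_comm]

/-! ### Hermite coefficients of one-dimensional modulated Gaussians -/

theorem integrable_hermiteGauss_mul_cexp (k : ℕ) (t : ℝ) :
    Integrable (fun x : ℝ => (hermiteGauss k x : ℂ) *
      Complex.exp (2 * Real.pi * Complex.I * t * x)) := by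
  have h : Integrable (hermiteGauss k) := by
    simpa using integrable_hermiteGauss_mul_eval k 1
  refine h.ofReal.mul_bdd (c := 1) (by fun_prop) (Filter.Eventually.of_forall fun x => ?_)
  rw [show 2 * Real.pi * Complex.I * (t : ℂ) * x = ((2 * Real.pi * t * x : ℝ) : ℂ) * Complex.I by
    push_cast; ring, Complex.norm_exp_ofReal_mul_I]

/-- Each integration by parts contributes 2πit/(2√π) = i√π t. -/
theorem integral_hermiteGauss_mul_cexp (k : ℕ) (t : ℝ) :
    ∫ x, (hermiteGauss k x : ℂ) * Complex.exp (2 * Real.pi * Complex.I * t * x) =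
      (Complex.I * √Real.pi * t) ^ k * ((√2)⁻¹ : ℝ) *
        Complex.exp (-(Real.pi * t ^ 2 / 2)) := by
  have hs := two_mul_sqrt_pi_pos
  induction k with
  | zero =>
    have h := fourierIntegral_gaussian (b := ((2 * Real.pi : ℝ) : ℂ))
      (by rw [Complex.ofReal_re]; positivity) (2 * Real.pi * t : ℂ)
    have e : ∀ x : ℝ, (hermiteGauss 0 x : ℂ) * Complex.exp (2 * Real.pi * Complex.I * t * x) =
        Complex.exp (Complex.I * (2 * Real.pi * t : ℂ) * x) *
          Complex.exp (-((2 * Real.pi : ℝ) : ℂ) * x ^ 2) := by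
      intro x
      simp only [hermiteGauss]
      push_cast
      simp only [Polynomial.hermite_zero, map_one, Complex.ofReal_one, one_mul]
      rw [mul_comm]
      congr 2
      ring
    simp only [e]
    rw [h]
    have hp : (Real.pi : ℂ) ≠ 0 := by exact_mod_cast Real.pi_ne_zero
    have e1 : (Real.pi / ((2 * Real.pi : ℝ) : ℂ)) = ((2⁻¹ : ℝ) : ℂ) := by
      push_cast
      field_simp
    have e3 : (1 / 2 : ℂ) = ((1 / 2 : ℝ) : ℂ) := by push_cast; rfl
    rw [e1, e3, ← Complex.ofReal_cpow (by positivity), ← Real.sqrt_eq_rpow, Real.sqrt_inv, pow_zero,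
      one_mul]
    congr 2
    push_cast
    field_simp
    ring
  | succ k ih =>
    have hd : ∀ x : ℝ, HasDerivAt (fun x : ℝ => Complex.exp (2 * Real.pi * Complex.I * t * x))
        (2 * Real.pi * Complex.I * t * Complex.exp (2 * Real.pi * Complex.I * t * x)) x := by
      intro x
      have h1 : HasDerivAt (fun x : ℝ => (x : ℂ)) 1 x := Complex.ofRealCLM.hasDerivAt
      have := (h1.const_mul (2 * Real.pi * Complex.I * t : ℂ)).cexp
      convert! this using 1
      ring
    have h := integral_mul_deriv_eq_deriv_mul_of_integrable (u := fun x => (hermiteGauss k x : ℂ))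
      (fun x _ => (hasDerivAt_hermiteGauss k x).ofReal_comp) (fun x _ => hd x)
      (by
        refine ((integrable_hermiteGauss_mul_cexp k t).const_mul
          (2 * Real.pi * Complex.I * t)).congr (Filter.Eventually.of_forall fun x => ?_)
        simp only [Pi.mul_apply]
        ring)
      (by
        refine ((integrable_hermiteGauss_mul_cexp (k + 1) t).const_mul
          (-(2 * √Real.pi : ℂ))).congr (Filter.Eventually.of_forall fun x => ?_)
        simp only [Pi.mul_apply]
        push_cast
        ring)
      (integrable_hermiteGauss_mul_cexp k t)
    have h1 : ∀ x : ℝ, (hermiteGauss k x : ℂ) * (2 * Real.pi * Complex.I * t *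
        Complex.exp (2 * Real.pi * Complex.I * t * x)) = (2 * Real.pi * Complex.I * t) *
        ((hermiteGauss k x : ℂ) * Complex.exp (2 * Real.pi * Complex.I * t * x)) := fun x => by ring
    have h2 : ∀ x : ℝ, (((-(2 * √Real.pi) * hermiteGauss (k + 1) x : ℝ) : ℂ)) *
        Complex.exp (2 * Real.pi * Complex.I * t * x) = (-(2 * √Real.pi : ℂ)) *
        ((hermiteGauss (k + 1) x : ℂ) * Complex.exp (2 * Real.pi * Complex.I * t * x)) :=
      fun x => by push_cast; ring
    simp only [h1, h2, integral_const_mul] at h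
    rw [ih] at h
    have hs' : (√Real.pi : ℂ) ≠ 0 := by
      exact_mod_cast (Real.sqrt_pos.2 Real.pi_pos).ne'
    have hss : (√Real.pi : ℂ) ^ 2 = Real.pi := by
      exact_mod_cast Real.sq_sqrt Real.pi_pos.le
    have h2s : (2 * √Real.pi : ℂ) ≠ 0 := mul_ne_zero two_ne_zero hs'
    apply mul_left_cancel₀ h2s
    linear_combination -h - 2 * Complex.I * t * ((Complex.I * √Real.pi * t) ^ k *
      ((√2)⁻¹ : ℝ) * Complex.exp (-(Real.pi * t ^ 2 / 2))) * hss

/-- The Hermite coefficients of `x ↦ e^{-πx² + 2πitx}`. -/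
def hermiteCoeff (k : ℕ) (t : ℝ) : ℂ :=
  ((2 : ℝ) ^ (1 / 4 : ℝ) / √2 : ℝ) * Complex.exp (-(Real.pi * t ^ 2 / 2)) *
    ((Complex.I * √Real.pi * t) ^ k / (√(k.factorial : ℝ) : ℝ))

theorem integral_hermiteFun_mul_cexp (k : ℕ) (t : ℝ) :
    ∫ x : ℝ, (hermiteFun k x : ℂ) *
      Complex.exp (-Real.pi * x ^ 2 + 2 * Real.pi * Complex.I * t * x) = hermiteCoeff k t := by
  have h1 : ∀ x : ℝ, (hermiteFun k x : ℂ) *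
      Complex.exp (-Real.pi * x ^ 2 + 2 * Real.pi * Complex.I * t * x) =
      (((2 : ℝ) ^ (1 / 4 : ℝ) / √(k.factorial : ℝ) : ℝ) : ℂ) *
        ((hermiteGauss k x : ℂ) * Complex.exp (2 * Real.pi * Complex.I * t * x)) := by
    intro x
    have e2 : Real.exp (-(Real.pi * x ^ 2)) * Real.exp (-(Real.pi * x ^ 2)) =
        Real.exp (-(2 * Real.pi) * x ^ 2) := by
      rw [← Real.exp_add]
      ring_nf
    have e3 : Complex.exp (-Real.pi * x ^ 2) = ((Real.exp (-(Real.pi * x ^ 2)) : ℝ) : ℂ) := by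
      push_cast
      ring_nf
    rw [Complex.exp_add, e3, hermiteFun_eq, hermiteGauss, ← e2]
    push_cast
    ring
  simp only [h1]
  rw [integral_const_mul, integral_hermiteGauss_mul_cexp, hermiteCoeff]
  push_cast
  ring

/-! ### Modulated Gaussians and completeness of the Hermite functions -/

variable {n : ℕ}

theorem inner_toLp {f g : Config n → ℂ} (hf : MemLp f 2) (hg : MemLp g 2) :
    inner ℂ (hf.toLp f : L2 n) (hg.toLp g) = ∫ x, g x * (starRingEnd ℂ) (f x) := by
  rw [L2.inner_def]
  refine integral_congr_ae ?_
  filter_upwards [hf.coeFn_toLp, hg.coeFn_toLp] with x h1 h2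
  rw [h1, h2, RCLike.inner_apply]

theorem integral_prod_config (f : Fin n → ℝ → ℂ) :
    ∫ x : Config n, ∏ j, f j (x j) = ∏ j, ∫ x, f j x := by
  rw [← integral_fintype_prod_volume_eq_prod]
  exact (PiLp.volume_preserving_ofLp (Fin n)).integral_comp
    (MeasurableEquiv.toLp 2 (Fin n → ℝ)).symm.measurableEmbedding (fun x => ∏ j, f j (x j))

theorem orthonormal_hermiteL2 : Orthonormal ℂ (fun α : Fin n → ℕ => hermiteL2 α) := by
  classical
  rw [orthonormal_iff_ite]
  intro α β
  rw [hermiteL2, hermiteL2, inner_toLp]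
  have h : ∀ x : Config n, hermiteFunN β x * (starRingEnd ℂ) (hermiteFunN α x) =
      ∏ j, ((hermiteFun (α j) (x j) * hermiteFun (β j) (x j) : ℝ) : ℂ) := by
    intro x
    simp only [hermiteFunN, map_prod, Complex.conj_ofReal, ← Finset.prod_mul_distrib]
    refine Finset.prod_congr rfl fun j _ => ?_
    push_cast
    ring
  simp only [h]
  rw [integral_prod_config (fun j y => ((hermiteFun (α j) y * hermiteFun (β j) y : ℝ) : ℂ))]
  simp only [integral_complex_ofReal, integral_hermiteFun_mul]
  split_ifs with hab
  · subst hab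
    simp
  · obtain ⟨j, hj⟩ := Function.ne_iff.1 hab
    exact Finset.prod_eq_zero (Finset.mem_univ j) (by simp [hj])

/-- The modulated Gaussian `e^{-π|x|² + 2πi t·x}`. -/
def modGauss (t x : Config n) : ℂ :=
  Complex.exp (-Real.pi * ‖x‖ ^ 2 + 2 * Real.pi * Complex.I * inner ℝ t x)

theorem continuous_modGauss (t : Config n) : Continuous (modGauss t) := by
  unfold modGauss
  fun_prop

theorem norm_modGauss (t x : Config n) : ‖modGauss t x‖ = Real.exp (-Real.pi * ‖x‖ ^ 2) := by
  rw [modGauss, Complex.norm_exp]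
  congr 1
  have : (-Real.pi * (‖x‖ : ℂ) ^ 2 + 2 * Real.pi * Complex.I * inner ℝ t x) =
    ((-Real.pi * ‖x‖ ^ 2 : ℝ) : ℂ) + ((2 * Real.pi * inner ℝ t x : ℝ) : ℂ) * Complex.I := by
    push_cast
    ring
  rw [this, Complex.add_re, Complex.re_ofReal_mul, Complex.I_re, mul_zero, add_zero,
    Complex.ofReal_re]

theorem integrable_gauss {b : ℝ} (hb : 0 < b) :
    Integrable (fun x : Config n => Real.exp (-b * ‖x‖ ^ 2)) := by
  have h := (GaussianFourier.integrable_cexp_neg_mul_sq_norm_add (b := (b : ℂ))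
    (by simpa using hb) 0 (0 : Config n)).re
  refine h.congr (Filter.Eventually.of_forall fun x => ?_)
  have : (-(b : ℂ) * (‖x‖ : ℂ) ^ 2 + 0 * ((inner ℝ (0 : Config n) x : ℝ) : ℂ)) =
    ((-b * ‖x‖ ^ 2 : ℝ) : ℂ) := by
    push_cast
    ring
  simp only [this]
  exact Complex.exp_ofReal_re _

theorem memLp_modGauss (t : Config n) : MemLp (modGauss t) 2 := by
  rw [memLp_two_iff_integrable_sq_norm (continuous_modGauss t).aestronglyMeasurable]
  refine (integrable_gauss (b := 2 * Real.pi) (by positivity)).congr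
    (Filter.Eventually.of_forall fun x => ?_)
  simp only [norm_modGauss, ← Real.exp_nat_mul]
  push_cast
  ring_nf

/-- The modulated Gaussian as an element of `L²`. -/
def modGaussL2 (t : Config n) : L2 n := (memLp_modGauss t).toLp _

theorem modGauss_eq_prod (t x : Config n) : modGauss t x = ∏ j,
    Complex.exp (-Real.pi * (x j : ℂ) ^ 2 + 2 * Real.pi * Complex.I * t j * x j) := by
  rw [modGauss, ← Complex.exp_sum, Finset.sum_add_distrib, ← Finset.mul_sum]
  congr 2
  · rw [← Complex.ofReal_pow, EuclideanSpace.real_norm_sq_eq]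
    push_cast
    rfl
  · rw [PiLp.inner_apply]
    push_cast
    rw [Finset.mul_sum]
    refine Finset.sum_congr rfl fun j _ => ?_
    simp
    ring

theorem inner_hermiteL2_modGaussL2 (α : Fin n → ℕ) (t : Config n) :
    inner ℂ (hermiteL2 α) (modGaussL2 t) = ∏ j, hermiteCoeff (α j) (t j) := by
  rw [hermiteL2, modGaussL2, inner_toLp]
  have h : ∀ x : Config n, modGauss t x * (starRingEnd ℂ) (hermiteFunN α x) =
      ∏ j, (hermiteFun (α j) (x j) : ℂ) *
        Complex.exp (-Real.pi * (x j : ℂ) ^ 2 + 2 * Real.pi * Complex.I * t j * x j) := by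
    intro x
    rw [modGauss_eq_prod, Finset.prod_mul_distrib, mul_comm]
    simp only [hermiteFunN, map_prod, Complex.conj_ofReal]
  simp only [h]
  rw [integral_prod_config (fun j y => (hermiteFun (α j) y : ℂ) *
        Complex.exp (-Real.pi * (y : ℂ) ^ 2 + 2 * Real.pi * Complex.I * t j * y))]
  simp only [integral_hermiteFun_mul_cexp]

theorem norm_modGaussL2_sq (t : Config n) : ‖modGaussL2 t‖ ^ 2 = ((√2)⁻¹) ^ n := by
  rw [← Complex.ofReal_inj]
  have h0 : ((‖modGaussL2 t‖ ^ 2 : ℝ) : ℂ) = inner ℂ (modGaussL2 t) (modGaussL2 t) := by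
    push_cast
    exact (inner_self_eq_norm_sq_to_K (𝕜 := ℂ) (modGaussL2 t)).symm
  rw [h0, modGaussL2, inner_toLp]
  have h : ∀ x : Config n, modGauss t x * (starRingEnd ℂ) (modGauss t x) =
      ((Real.exp (-(2 * Real.pi) * ‖x‖ ^ 2) : ℝ) : ℂ) := by
    intro x
    rw [Complex.mul_conj', norm_modGauss, ← Complex.ofReal_pow, ← Real.exp_nat_mul]
    push_cast
    ring_nf
  simp only [h]
  rw [integral_complex_ofReal, GaussianFourier.integral_rexp_neg_mul_sq_norm (by positivity)]
  have e : Real.pi / (2 * Real.pi) = 2⁻¹ := by field_simp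
  rw [e, finrank_euclideanSpace_fin, div_eq_mul_inv, mul_comm, Real.rpow_mul (by norm_num),
    Real.rpow_natCast, ← one_div (2 : ℝ), ← Real.sqrt_eq_rpow, one_div, Real.sqrt_inv]

theorem sum_piAntidiag_prod_pow_div_factorial (x : Fin n → ℂ) (k : ℕ) :
    ∑ α ∈ Finset.piAntidiag Finset.univ k, ∏ j, (x j ^ α j / ((α j).factorial : ℂ)) =
      (∑ j, x j) ^ k / (k.factorial : ℂ) := by
  rw [Finset.sum_pow_eq_sum_piAntidiag, Finset.sum_div]
  refine Finset.sum_congr rfl fun α hα => ?_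
  have hα' : ∑ j, α j = k := (Finset.mem_piAntidiag.1 hα).1
  have h := Nat.multinomial_spec Finset.univ α
  rw [hα'] at h
  have hp : (∏ j, ((α j).factorial : ℂ)) ≠ 0 :=
    Finset.prod_ne_zero_iff.2 fun j _ => by exact_mod_cast (α j).factorial_ne_zero
  have hk : (k.factorial : ℂ) ≠ 0 := by exact_mod_cast k.factorial_ne_zero
  have h' : (∏ j, ((α j).factorial : ℂ)) * (Nat.multinomial Finset.univ α : ℂ) = k.factorial := by
    exact_mod_cast h
  rw [Finset.prod_div_distrib, div_eq_div_iff hp hk, ← h']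
  ring

theorem conj_hermiteCoeff_mul (k : ℕ) (s t : ℝ) :
    (starRingEnd ℂ) (hermiteCoeff k s) * hermiteCoeff k t =
      ((√2)⁻¹ : ℝ) * Complex.exp (-(Real.pi * (s ^ 2 + t ^ 2) / 2)) *
        ((Real.pi * (s * t)) ^ k / (k.factorial : ℂ)) := by
  have e1 : (((2 : ℝ) ^ (1 / 4 : ℝ) / √2) * ((2 : ℝ) ^ (1 / 4 : ℝ) / √2)) = (√2)⁻¹ := by
    have h1 : (2 : ℝ) ^ (1 / 4 : ℝ) * (2 : ℝ) ^ (1 / 4 : ℝ) = √2 := by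
      rw [← Real.rpow_add two_pos, Real.sqrt_eq_rpow]
      norm_num
    rw [div_mul_div_comm, h1]
    field_simp
  have e2 : ((√(k.factorial : ℝ) : ℝ) : ℂ) * ((√(k.factorial : ℝ) : ℝ) : ℂ) = k.factorial := by
    rw [← Complex.ofReal_mul, Real.mul_self_sqrt (by positivity)]
    norm_cast
  have e3 : (starRingEnd ℂ) (Complex.exp (-(Real.pi * s ^ 2 / 2))) =
      Complex.exp (-(Real.pi * s ^ 2 / 2)) := by
    rw [← Complex.exp_conj]
    simp [Complex.conj_ofNat]
  have e4 : (starRingEnd ℂ) (Complex.I * √Real.pi * s) * (Complex.I * √Real.pi * t) =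
      Real.pi * (s * t) := by
    have hss : (√Real.pi : ℂ) ^ 2 = Real.pi := by
      exact_mod_cast Real.sq_sqrt Real.pi_pos.le
    simp only [map_mul, Complex.conj_I, Complex.conj_ofReal]
    linear_combination (s * t : ℂ) * hss - (√Real.pi : ℂ) ^ 2 * s * t * Complex.I_sq
  have e5 : Complex.exp (-(Real.pi * (s ^ 2 + t ^ 2) / 2)) =
      Complex.exp (-(Real.pi * s ^ 2 / 2)) * Complex.exp (-(Real.pi * t ^ 2 / 2)) := by
    rw [← Complex.exp_add]
    ring_nf
  rw [hermiteCoeff, hermiteCoeff, ← e1, ← e2, e5, ← e4, map_mul, map_mul, map_div₀, map_pow,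
    Complex.conj_ofReal, Complex.conj_ofReal, e3, mul_pow]
  push_cast
  ring

/-- The multinomial theorem with variables π s_j t_j. The case s = t gives completeness, the general
case the spectral expansion. -/
theorem sum_level_inner_modGaussL2 (s t : Config n) (k : ℕ) :
    ∑ α ∈ Finset.piAntidiag (Finset.univ : Finset (Fin n)) k,
      inner ℂ (modGaussL2 s) (hermiteL2 α) * inner ℂ (hermiteL2 α) (modGaussL2 t) =
    ((√2)⁻¹ : ℝ) ^ n * Complex.exp (-(Real.pi * (‖s‖ ^ 2 + ‖t‖ ^ 2) / 2)) *
      ((Real.pi * (inner ℝ s t : ℝ)) ^ k / (k.factorial : ℂ)) := by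
  have h : ∀ α : Fin n → ℕ,
      inner ℂ (modGaussL2 s) (hermiteL2 α) * inner ℂ (hermiteL2 α) (modGaussL2 t) =
      ((√2)⁻¹ : ℝ) ^ n * Complex.exp (-(Real.pi * (‖s‖ ^ 2 + ‖t‖ ^ 2) / 2)) *
        ∏ j, ((Real.pi * (s j * t j) : ℂ) ^ α j / ((α j).factorial : ℂ)) := by
    intro α
    rw [← inner_conj_symm, inner_hermiteL2_modGaussL2, inner_hermiteL2_modGaussL2, map_prod,
      ← Finset.prod_mul_distrib]
    simp only [conj_hermiteCoeff_mul]
    rw [Finset.prod_mul_distrib, Finset.prod_mul_distrib, Finset.prod_const, ← Complex.exp_sum,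
      Finset.card_univ, Fintype.card_fin]
    congr 3
    rw [← Complex.ofReal_pow ‖s‖, ← Complex.ofReal_pow ‖t‖, EuclideanSpace.real_norm_sq_eq,
      EuclideanSpace.real_norm_sq_eq]
    push_cast
    rw [← Finset.sum_add_distrib, Finset.mul_sum, Finset.sum_div, Finset.sum_neg_distrib]
  simp only [h]
  rw [← Finset.mul_sum, sum_piAntidiag_prod_pow_div_factorial, ← Finset.mul_sum]
  congr 3
  rw [PiLp.inner_apply]
  push_cast
  congr 1
  refine Finset.sum_congr rfl fun j _ => ?_
  simp [mul_comm]

theorem HasSum.level {E : Type*} [NormedAddCommGroup E] {f : (Fin n → ℕ) → E} {S : E}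
    (h : HasSum f S) :
    HasSum (fun k => ∑ α ∈ Finset.piAntidiag (Finset.univ : Finset (Fin n)) k, f α) S := by
  classical
  have h1 := (Equiv.sigmaFiberEquiv (fun α : Fin n → ℕ => ∑ j, α j)).hasSum_iff.2 h
  refine h1.sigma fun k => ?_
  have h2 := (Finset.piAntidiag (Finset.univ : Finset (Fin n)) k).hasSum f
  have e : ∀ α : Fin n → ℕ, (∑ j, α j) = k ↔ α ∈ Finset.piAntidiag Finset.univ k := by
    intro α
    simp [Finset.mem_piAntidiag]
  exact (Equiv.subtypeEquivRight e).hasSum_iff.2 h2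

/-- Summing the levels gives e^{π|t|²}, which cancels the Gaussian prefactor. -/
theorem tsum_norm_inner_hermiteL2_modGaussL2 (t : Config n) :
    ∑' α : Fin n → ℕ, ‖inner ℂ (hermiteL2 α) (modGaussL2 t)‖ ^ 2 = ‖modGaussL2 t‖ ^ 2 := by
  have h1 := (orthonormal_hermiteL2.inner_products_summable (modGaussL2 t)).hasSum
  have h2 := HasSum.level (Complex.hasSum_ofReal.2 h1)
  have h3 : ∀ k : ℕ, ∑ α ∈ Finset.piAntidiag (Finset.univ : Finset (Fin n)) k,
      ((‖inner ℂ (hermiteL2 α) (modGaussL2 t)‖ ^ 2 : ℝ) : ℂ) =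
      ((√2)⁻¹ : ℝ) ^ n * Complex.exp (-(Real.pi * (‖t‖ ^ 2 + ‖t‖ ^ 2) / 2)) *
      ((Real.pi * (inner ℝ t t : ℝ)) ^ k / (k.factorial : ℂ)) := by
    intro k
    rw [← sum_level_inner_modGaussL2]
    refine Finset.sum_congr rfl fun α _ => ?_
    rw [← inner_conj_symm (modGaussL2 t), Complex.conj_mul']
    push_cast
    rfl
  simp only [h3] at h2
  have h4 := (NormedSpace.expSeries_div_hasSum_exp
    (Real.pi * (inner ℝ t t : ℝ) : ℂ)).mul_left
      (((√2)⁻¹ : ℝ) ^ n * Complex.exp (-(Real.pi * (‖t‖ ^ 2 + ‖t‖ ^ 2) / 2)) : ℂ)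
  have h5 := h2.unique h4
  rw [← Complex.exp_eq_exp_ℂ, mul_assoc, ← Complex.exp_add, real_inner_self_eq_norm_sq] at h5
  rw [norm_modGaussL2_sq, ← Complex.ofReal_inj, h5]
  push_cast
  rw [show -(Real.pi * ((‖t‖ : ℂ) ^ 2 + ‖t‖ ^ 2) / 2) + Real.pi * ‖t‖ ^ 2 = 0 by ring,
    Complex.exp_zero, mul_one]

/-- Equality in Bessel makes x the limit of its partial expansions, all orthogonal to u;
Cauchy–Schwarz against the remainder makes this quantitative. -/
theorem Orthonormal.inner_eq_zero_of_tsum_eq {ι E : Type*} [NormedAddCommGroup E]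
    [InnerProductSpace ℂ E] {v : ι → E} (hv : Orthonormal ℂ v) {x u : E}
    (hx : ∑' i, ‖inner ℂ (v i) x‖ ^ 2 = ‖x‖ ^ 2) (hu : ∀ i, inner ℂ (v i) u = 0) :
    inner ℂ u x = 0 := by
  have key : ∀ s : Finset ι,
      ‖inner ℂ u x‖ ^ 2 ≤ ‖u‖ ^ 2 * (‖x‖ ^ 2 - ∑ i ∈ s, ‖inner ℂ (v i) x‖ ^ 2) := by
    intro s
    have h₂ : (∑ i ∈ s, ∑ j ∈ s, inner ℂ (v i) x * inner ℂ x (v j) * inner ℂ (v j) (v i)) =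
        (∑ k ∈ s, inner ℂ (v k) x * inner ℂ x (v k) : ℂ) := hv.inner_left_right_finset
    have h₃ : ∀ z : ℂ, RCLike.re (z * (starRingEnd ℂ) z) = ‖z‖ ^ 2 := by
      intro z
      simp only [RCLike.mul_conj]
      norm_cast
    have hbf : ‖x - ∑ i ∈ s, inner ℂ (v i) x • v i‖ ^ 2 =
        ‖x‖ ^ 2 - ∑ i ∈ s, ‖inner ℂ (v i) x‖ ^ 2 := by
      rw [@norm_sub_sq ℂ, sub_add]
      simp only [@InnerProductSpace.norm_sq_eq_re_inner ℂ E, inner_sum, sum_inner]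
      simp only [inner_smul_right, two_mul, inner_smul_left, inner_conj_symm, ← mul_assoc, h₂,
        add_sub_cancel_right, sub_right_inj]
      simp only [map_sum, ← inner_conj_symm x, ← h₃]
    have h1 : inner ℂ u (x - ∑ i ∈ s, inner ℂ (v i) x • v i) = inner ℂ u x := by
      have hu' : ∀ i, inner ℂ u (v i) = 0 := fun i => by
        rw [← inner_conj_symm, hu, map_zero]
      simp [hu']
    rw [← hbf, ← mul_pow, ← h1]
    gcongr
    exact norm_inner_le_norm _ _
  have hlim : Filter.Tendsto (fun s : Finset ι =>
      ‖u‖ ^ 2 * (‖x‖ ^ 2 - ∑ i ∈ s, ‖inner ℂ (v i) x‖ ^ 2)) Filter.atTop (nhds 0) := by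
    have h := ((hv.inner_products_summable x).hasSum.const_sub (‖x‖ ^ 2)).const_mul (‖u‖ ^ 2)
    rwa [hx, sub_self, mul_zero] at h
  have := ge_of_tendsto' hlim key
  have h0 : ‖inner ℂ u x‖ ^ 2 = 0 := le_antisymm this (by positivity)
  simpa using h0

-- These inner products form the Fourier transform of the integrable function e^{-π|x|²}u, and the
-- weight never vanishes.
open FourierTransform in
theorem eq_zero_of_inner_modGaussL2 {u : L2 n} (hu : ∀ t, inner ℂ (modGaussL2 t) u = 0) :
    u = 0 := by
  set h : Config n → ℂ := fun x => (Real.exp (-Real.pi * ‖x‖ ^ 2) : ℂ) * u x with hh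
  have hg : MemLp (fun x : Config n => (Real.exp (-Real.pi * ‖x‖ ^ 2) : ℂ)) 2 := by
    refine (memLp_modGauss (0 : Config n)).congr_norm ?_ ?_
    · exact Continuous.aestronglyMeasurable (by fun_prop)
    · refine Filter.Eventually.of_forall fun x => ?_
      rw [norm_modGauss, Complex.norm_real, Real.norm_of_nonneg (Real.exp_pos _).le]
  have hint : Integrable h := hg.integrable_mul (Lp.memLp u)
  have hF : ∀ t, 𝓕 h t = 0 := by
    intro t
    rw [← hu t, modGaussL2, ← (Lp.toLp_coeFn u (Lp.memLp u)), inner_toLp, Real.fourier_eq']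
    refine integral_congr_ae (Filter.Eventually.of_forall fun x => ?_)
    simp only [hh, smul_eq_mul, modGauss, ← Complex.exp_conj]
    rw [mul_comm (u x), ← mul_assoc]
    congr 1
    push_cast
    rw [← Complex.exp_add]
    congr 1
    simp [Complex.conj_ofNat]
    rw [real_inner_comm]
    ring
  have hz : ∀ᵐ x, h x = 0 := by
    refine ae_eq_zero_of_integral_contDiff_smul_eq_zero hint.locallyIntegrable fun g hg hgs => ?_
    -- A test function is the Fourier transform of a Schwartz function; the transform is then moved
    -- onto `h`, where it is zero.
    set G : 𝓢(Config n, ℂ) := HasCompactSupport.toSchwartzMap (f := fun x => (g x : ℂ))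
      (hgs.comp_left Complex.ofReal_zero) (Complex.ofRealCLM.contDiff.comp hg)
    have e1 : ∀ x, (g x : ℂ) = 𝓕 (⇑(𝓕⁻ G : 𝓢(Config n, ℂ))) x := by
      intro x
      rw [← SchwartzMap.fourier_coe, FourierTransform.fourier_fourierInv_eq]
      rfl
    have e2 := VectorFourier.integral_fourierIntegral_smul_eq_flip (L := innerₗ (Config n))
      Real.continuous_fourierChar continuous_inner ((𝓕⁻ G : 𝓢(Config n, ℂ)).integrable (μ := volume)) hint
    have e3 : ∫ x, g x • h x = ∫ x, 𝓕 (⇑(𝓕⁻ G : 𝓢(Config n, ℂ))) x • h x := by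
      refine integral_congr_ae (Filter.Eventually.of_forall fun x => ?_)
      simp only
      rw [← e1]
      simp
    rw [e3]
    refine e2.trans ?_
    rw [← integral_zero (Config n) ℂ]
    refine integral_congr_ae (Filter.Eventually.of_forall fun x => ?_)
    have := hF x
    simp only [flip_innerₗ]
    exact (congrArg _ this).trans (smul_zero _)
  rw [Lp.eq_zero_iff_ae_eq_zero]
  filter_upwards [hz] with x hx
  have : (Real.exp (-Real.pi * ‖x‖ ^ 2) : ℂ) ≠ 0 := by
    exact_mod_cast (Real.exp_pos _).ne'
  exact (mul_eq_zero.1 hx).resolve_left this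

theorem span_hermiteL2_orthogonal :
    (Submodule.span ℂ (Set.range (fun α : Fin n → ℕ => hermiteL2 α)))ᗮ = ⊥ := by
  rw [Submodule.eq_bot_iff]
  intro u hu
  apply eq_zero_of_inner_modGaussL2
  intro t
  rw [← inner_conj_symm, Orthonormal.inner_eq_zero_of_tsum_eq orthonormal_hermiteL2
    (tsum_norm_inner_hermiteL2_modGaussL2 t), map_zero]
  intro α
  exact (Submodule.mem_orthogonal _ _).1 hu _ (Submodule.subset_span ⟨α, rfl⟩)

theorem topologicalClosure_span_modGaussL2 :
    (Submodule.span ℂ (Set.range (fun t : Config n => modGaussL2 t))).topologicalClosure = ⊤ := by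
  rw [Submodule.topologicalClosure_eq_top_iff, Submodule.eq_bot_iff]
  intro u hu
  exact eq_zero_of_inner_modGaussL2 fun t =>
    (Submodule.mem_orthogonal _ _).1 hu _ (Submodule.subset_span ⟨t, rfl⟩)

/-- The Hermite functions as a Hilbert basis. -/
def hermiteBasis (n : ℕ) : HilbertBasis (Fin n → ℕ) ℂ (L2 n) :=
  HilbertBasis.mkOfOrthogonalEqBot orthonormal_hermiteL2 span_hermiteL2_orthogonal

theorem hermiteBasis_apply (α : Fin n → ℕ) : hermiteBasis n α = hermiteL2 α := by
  rw [hermiteBasis, HilbertBasis.coe_mkOfOrthogonalEqBot]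

/-! ### Operators diagonal in the Hermite basis -/

theorem hermiteProj_apply (α : Fin n → ℕ) (u : L2 n) :
    hermiteProj α u = inner ℂ (hermiteL2 α) u • hermiteL2 α :=
  Submodule.starProjection_unit_singleton ℂ (orthonormal_hermiteL2.1 α) u

/-- A bounded multiplier on ℓ², transported by the Hermite basis. -/
theorem exists_diagonal_operator {F : (Fin n → ℕ) → ℂ} {C : ℝ} (hC : ∀ α, ‖F α‖ ≤ C) :
    ∃ D : L2 n →L[ℂ] L2 n, ∀ u, HasSum (fun α => F α • hermiteProj α u) (D u) := by
  have hC0 : 0 ≤ C := (norm_nonneg _).trans (hC 0)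
  set b := hermiteBasis n
  let T : lp (fun _ : Fin n → ℕ => ℂ) 2 →L[ℂ] lp (fun _ : Fin n → ℕ => ℂ) 2 :=
    lp.mapCLM 2 (fun α => F α • ContinuousLinearMap.id ℂ ℂ) hC0 fun α => by
      rw [norm_smul]
      simpa using hC α
  refine ⟨(b.repr.symm.toContinuousLinearEquiv : _ →L[ℂ] L2 n) ∘L T ∘L
    (b.repr.toContinuousLinearEquiv : L2 n →L[ℂ] _), fun u => ?_⟩
  have h := b.hasSum_repr_symm (T (b.repr u))
  convert! h using 2 with α
  rw [hermiteProj_apply, hermiteBasis_apply]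
  simp only [T, lp.mapCLM_apply_coe, b.repr_apply_apply, b, hermiteBasis_apply]
  simp [smul_smul]

/-! ### The Wigner distribution on `L²` -/

/-- The substitution y = x + z/2, with Jacobian 2^n, exhibits W at a point as a matrix coefficient
of the phase-space reflection there. -/
theorem wigner_eq_integral_reflection (u v : Config n → ℂ) (x ξ : Config n) :
    wigner u v x ξ = 2 ^ n * ∫ y : Config n,
      Complex.exp (-4 * Complex.I * Real.pi * (inner ℝ (y - x) ξ : ℝ)) * u y *
        (starRingEnd ℂ) (v ((2 : ℝ) • x - y)) := by
  set g : Config n → ℂ := fun w => Complex.exp (-4 * Complex.I * Real.pi * (inner ℝ w ξ : ℝ)) *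
    u (x + w) * (starRingEnd ℂ) (v (x - w)) with hg
  have h1 : wigner u v x ξ = ∫ z : Config n, g ((1 / 2 : ℝ) • z) := by
    rw [wigner]
    refine integral_congr_ae (Filter.Eventually.of_forall fun z => ?_)
    simp only [hg, real_inner_smul_left]
    congr 3
    push_cast
    ring
  have h2 := integral_sub_right_eq_self (μ := (volume : Measure (Config n))) g x
  rw [h1, Measure.integral_comp_smul, ← h2, finrank_euclideanSpace_fin]
  have h3 : |((1 / 2 : ℝ) ^ n)⁻¹| = 2 ^ n := by
    rw [abs_of_pos (by positivity)]
    simp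
  rw [h3, Complex.real_smul]
  push_cast
  congr 1
  refine integral_congr_ae (Filter.Eventually.of_forall fun y => ?_)
  simp only [hg]
  rw [add_sub_cancel, sub_sub_eq_add_sub, two_smul]

theorem wigner_congr {u u' v v' : Config n → ℂ} (hu : u =ᵐ[volume] u') (hv : v =ᵐ[volume] v')
    (x ξ : Config n) : wigner u v x ξ = wigner u' v' x ξ := by
  rw [wigner_eq_integral_reflection, wigner_eq_integral_reflection]
  congr 1
  refine integral_congr_ae ?_
  have hv' := (Measure.measurePreserving_sub_left (volume : Measure (Config n))
    ((2 : ℝ) • x)).quasiMeasurePreserving.ae_eq_comp hv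
  filter_upwards [hu, hv'] with y h1 h2
  simp only [Function.comp_apply] at h2
  rw [h1, h2]

theorem conj_wigner (u v : Config n → ℂ) (x ξ : Config n) :
    (starRingEnd ℂ) (wigner u v x ξ) = wigner v u x ξ := by
  rw [wigner, wigner, ← integral_conj, ← integral_neg_eq_self]
  refine integral_congr_ae (Filter.Eventually.of_forall fun z => ?_)
  simp only [map_mul, Complex.conj_conj, ← Complex.exp_conj, smul_neg, inner_neg_left, neg_mul,
    sub_neg_eq_add, ← sub_eq_add_neg, map_neg, Complex.conj_I, Complex.conj_ofReal,
    Complex.conj_ofNat, Complex.ofReal_neg]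
  ring_nf

theorem wigner_self_im (u : Config n → ℂ) (x ξ : Config n) : (wigner u u x ξ).im = 0 :=
  Complex.conj_eq_iff_im.1 (conj_wigner u u x ξ)

theorem norm_cexp_four_inner (x ξ y : Config n) :
    ‖Complex.exp (4 * Complex.I * Real.pi * (inner ℝ (y - x) ξ : ℝ))‖ = 1 := by
  rw [show 4 * Complex.I * Real.pi * ((inner ℝ (y - x) ξ : ℝ) : ℂ) =
    ((4 * Real.pi * inner ℝ (y - x) ξ : ℝ) : ℂ) * Complex.I by push_cast; ring,
    Complex.norm_exp_ofReal_mul_I]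

theorem memLp_reflection (x ξ : Config n) (v : L2 n) :
    MemLp (fun y => Complex.exp (4 * Complex.I * Real.pi * (inner ℝ (y - x) ξ : ℝ)) *
      v ((2 : ℝ) • x - y)) 2 volume := by
  have hv := (Lp.memLp v).comp_measurePreserving (Measure.measurePreserving_sub_left
    (volume : Measure (Config n)) ((2 : ℝ) • x))
  refine hv.congr_norm ?_ (Filter.Eventually.of_forall fun y => ?_)
  · exact (Continuous.aestronglyMeasurable (by fun_prop)).mul hv.1
  · rw [norm_mul, norm_cexp_four_inner, one_mul]
    rfl

/-- The phase-space reflection at `(x, ξ)`. -/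
def reflection (x ξ : Config n) (v : L2 n) : L2 n := (memLp_reflection x ξ v).toLp _

theorem norm_reflection (x ξ : Config n) (v : L2 n) : ‖reflection x ξ v‖ = ‖v‖ := by
  rw [reflection, Lp.norm_toLp, Lp.norm_def, ← eLpNorm_comp_measurePreserving (Lp.memLp v).1
    (Measure.measurePreserving_sub_left (volume : Measure (Config n)) ((2 : ℝ) • x))]
  congr 1
  refine eLpNorm_congr_norm_ae (Filter.Eventually.of_forall fun y => ?_)
  rw [norm_mul, norm_cexp_four_inner, one_mul]
  rfl

theorem wigner_eq_inner (u v : L2 n) (x ξ : Config n) :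
    wigner u v x ξ = 2 ^ n * inner ℂ (reflection x ξ v) u := by
  rw [wigner_eq_integral_reflection]
  congr 1
  conv_rhs => rw [← Lp.toLp_coeFn u (Lp.memLp u)]
  rw [reflection, inner_toLp]
  refine integral_congr_ae (Filter.Eventually.of_forall fun y => ?_)
  simp only [map_mul, ← Complex.exp_conj, Complex.conj_I, Complex.conj_ofReal, Complex.conj_ofNat]
  ring_nf

/-- Cauchy–Schwarz, the reflection being isometric. This pointwise bound makes the form of the
compact ball bounded on L². -/
theorem norm_wigner_le (u v : L2 n) (x ξ : Config n) :
    ‖wigner u v x ξ‖ ≤ 2 ^ n * (‖v‖ * ‖u‖) := by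
  rw [wigner_eq_inner, norm_mul, ← norm_reflection x ξ v]
  have : ‖(2 : ℂ) ^ n‖ = 2 ^ n := by simp
  rw [this]
  gcongr
  exact norm_inner_le_norm _ _

theorem wigner_add_left (u u' v : L2 n) (x ξ : Config n) :
    wigner ↑↑(u + u') v x ξ = wigner u v x ξ + wigner u' v x ξ := by
  simp only [wigner_eq_inner, inner_add_right, mul_add]

theorem wigner_smul_left (c : ℂ) (u v : L2 n) (x ξ : Config n) :
    wigner ↑↑(c • u) v x ξ = c * wigner u v x ξ := by
  simp only [wigner_eq_inner, inner_smul_right]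
  ring

theorem wigner_add_right (u v v' : L2 n) (x ξ : Config n) :
    wigner u ↑↑(v + v') x ξ = wigner u v x ξ + wigner u v' x ξ := by
  rw [← conj_wigner, wigner_add_left, map_add, conj_wigner, conj_wigner]

theorem wigner_smul_right (c : ℂ) (u v : L2 n) (x ξ : Config n) :
    wigner u ↑↑(c • v) x ξ = (starRingEnd ℂ) c * wigner u v x ξ := by
  rw [← conj_wigner, wigner_smul_left, map_mul, conj_wigner]

theorem stronglyMeasurable_wigner (u v : L2 n) :
    StronglyMeasurable (fun p : Config n × Config n => wigner u v p.1 p.2) := by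
  unfold wigner
  refine StronglyMeasurable.integral_prod_right' (f := fun q : (Config n × Config n) × Config n =>
    Complex.exp (-2 * Complex.I * Real.pi * (inner ℝ q.2 q.1.2 : ℝ)) *
      u (q.1.1 + (1 / 2 : ℝ) • q.2) * (starRingEnd ℂ) (v (q.1.1 - (1 / 2 : ℝ) • q.2))) ?_
  have h1 := (Lp.stronglyMeasurable u).comp_measurable
    (g := fun q : (Config n × Config n) × Config n => q.1.1 + (1 / 2 : ℝ) • q.2) (by fun_prop)
  have h2 := (Lp.stronglyMeasurable v).comp_measurable
    (g := fun q : (Config n × Config n) × Config n => q.1.1 - (1 / 2 : ℝ) • q.2) (by fun_prop)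
  refine StronglyMeasurable.mul (StronglyMeasurable.mul ?_ h1) ?_
  · exact Continuous.stronglyMeasurable (by fun_prop)
  · exact Complex.continuous_conj.comp_stronglyMeasurable h2

/-! ### The quadratic form of the ball -/

theorem isCompact_phaseBall (a : ℝ) : IsCompact (phaseBall n a) := by
  refine Metric.isCompact_of_isClosed_isBounded ?_ ?_
  · exact isClosed_le (by fun_prop) continuous_const
  · refine (Metric.isBounded_closedBall (x := (0 : Config n × Config n)) (r := a + 1)).subset ?_
    intro p hp
    have hp' : 2 * Real.pi * (‖p.1‖ ^ 2 + ‖p.2‖ ^ 2) ≤ a := hp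
    have hpi := Real.pi_gt_three
    rw [mem_closedBall_zero_iff, Prod.norm_def, max_le_iff]
    constructor <;> nlinarith [sq_nonneg (‖p.1‖ - 1), sq_nonneg (‖p.2‖ - 1), sq_nonneg ‖p.1‖,
      sq_nonneg ‖p.2‖, mul_nonneg (sub_nonneg.2 hpi.le) (add_nonneg (sq_nonneg ‖p.1‖)
      (sq_nonneg ‖p.2‖))]

theorem measurableSet_phaseBall (a : ℝ) : MeasurableSet (phaseBall n a) :=
  (isCompact_phaseBall a).measurableSet

theorem integrableOn_wigner (u v : L2 n) (a : ℝ) :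
    IntegrableOn (fun p : Config n × Config n => wigner u v p.1 p.2) (phaseBall n a) :=
  IntegrableOn.of_bound (isCompact_phaseBall a).measure_lt_top
    (stronglyMeasurable_wigner u v).aestronglyMeasurable (2 ^ n * (‖v‖ * ‖u‖))
    (Filter.Eventually.of_forall fun p => norm_wigner_le u v p.1 p.2)

/-- The sesquilinear form `(v, u) ↦ ∬_{B_a} W(u, v)`. -/
def ballForm (n : ℕ) (a : ℝ) : L2 n →L⋆[ℂ] L2 n →L[ℂ] ℂ :=
  LinearMap.mkContinuous₂
    (LinearMap.mk₂'ₛₗ (starRingEnd ℂ) (RingHom.id ℂ)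
      (fun v u : L2 n => ∫ p in phaseBall n a, wigner u v p.1 p.2)
      (fun v v' u => by
        simp only [wigner_add_right]
        exact integral_add (integrableOn_wigner u v a) (integrableOn_wigner u v' a))
      (fun c v u => by
        simp only [wigner_smul_right, smul_eq_mul]
        exact integral_const_mul _ _)
      (fun v u u' => by
        simp only [wigner_add_left]
        exact integral_add (integrableOn_wigner u v a) (integrableOn_wigner u' v a))
      (fun c v u => by
        simp only [wigner_smul_left, smul_eq_mul, RingHom.id_apply]
        exact integral_const_mul _ _))
    (2 ^ n * volume.real (phaseBall n a)) (fun v u => by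
      have := norm_setIntegral_le_of_norm_le_const (μ := volume)
        (isCompact_phaseBall (n := n) a).measure_lt_top
        (f := fun p : Config n × Config n => wigner u v p.1 p.2)
        (fun p _ => norm_wigner_le u v p.1 p.2)
      refine this.trans_eq ?_
      ring)

theorem ballForm_apply (a : ℝ) (v u : L2 n) :
    ballForm n a v u = ∫ p in phaseBall n a, wigner u v p.1 p.2 := rfl

theorem coe_toLp_wigner (u v : 𝓢(Config n, ℂ)) (x ξ : Config n) :
    wigner (u.toLp 2 : L2 n) (v.toLp 2 : L2 n) x ξ = wigner u v x ξ := by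
  have hu : ((u.toLp 2 : L2 n) : Config n → ℂ) =ᵐ[volume] u := u.coeFn_toLp 2 volume
  have hv : ((v.toLp 2 : L2 n) : Config n → ℂ) =ᵐ[volume] v := v.coeFn_toLp 2 volume
  exact wigner_congr hu hv x ξ

theorem ballSymbol_mul_wigner (a : ℝ) (u v : 𝓢(Config n, ℂ)) :
    (fun p : Config n × Config n => ballSymbol n a p * wigner u v p.1 p.2) =
      (phaseBall n a).indicator
        (fun p => wigner (u.toLp 2 : L2 n) (v.toLp 2 : L2 n) p.1 p.2) := by
  funext p
  rw [ballSymbol]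
  by_cases hp : p ∈ phaseBall n a
  · rw [Set.indicator_of_mem hp, Set.indicator_of_mem hp, coe_toLp_wigner, Pi.one_apply, one_mul]
  · rw [Set.indicator_of_notMem hp, Set.indicator_of_notMem hp, zero_mul]

theorem integral_ballSymbol_mul_wigner (a : ℝ) (u v : 𝓢(Config n, ℂ)) :
    ∫ p : Config n × Config n, ballSymbol n a p * wigner u v p.1 p.2 =
      ballForm n a (v.toLp 2) (u.toLp 2) := by
  rw [ballSymbol_mul_wigner, integral_indicator (measurableSet_phaseBall a), ballForm_apply]

theorem inner_eq_ballForm_of_schwartz {a : ℝ} {Q : L2 n →L[ℂ] L2 n}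
    (h : ∀ u v : 𝓢(Config n, ℂ),
      inner ℂ (v.toLp 2 : L2 n) (Q (u.toLp 2)) = ballForm n a (v.toLp 2) (u.toLp 2))
    (u v : L2 n) : inner ℂ v (Q u) = ballForm n a v u := by
  have hd := SchwartzMap.denseRange_toLpCLM (E := Config n) (F := ℂ)
    (μ := (volume : Measure (Config n))) (p := 2) ENNReal.ofNat_ne_top
  have h1 : Continuous (fun q : L2 n × L2 n => inner ℂ q.2 (Q q.1)) := by fun_prop
  have h2 : Continuous (fun q : L2 n × L2 n => ballForm n a q.2 q.1) :=
    ((ballForm n a).continuous.comp continuous_snd).clm_apply continuous_fst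
  exact hd.induction_on₂ (p := fun u v : L2 n => inner ℂ v (Q u) = ballForm n a v u)
    (isClosed_eq h1 h2) h u v

theorem isWeylQuantization_ballSymbol_iff (a : ℝ) (Q : L2 n →L[ℂ] L2 n) :
    IsWeylQuantization (ballSymbol n a) Q ↔ ∀ u v, inner ℂ v (Q u) = ballForm n a v u := by
  constructor
  · intro hQ
    refine inner_eq_ballForm_of_schwartz fun u v => ?_
    rw [(hQ u v).2, integral_ballSymbol_mul_wigner]
  · intro h u v
    refine ⟨?_, ?_⟩
    · rw [ballSymbol_mul_wigner]
      exact (integrableOn_wigner _ _ a).integrable_indicator (measurableSet_phaseBall a)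
    · rw [h, integral_ballSymbol_mul_wigner]

/-! ### Wigner distributions of modulated Gaussians -/

theorem wigner_modGauss (t s x ξ : Config n) :
    wigner (modGauss t) (modGauss s) x ξ = (√2 : ℂ) ^ n *
      Complex.exp (-(2 * Real.pi) * ‖x‖ ^ 2 + 2 * Real.pi * Complex.I * inner ℝ (t - s) x) *
      Complex.exp (-(2 * Real.pi) * ‖ξ - (1 / 2 : ℝ) • (t + s)‖ ^ 2) := by
  set w : Config n := (1 / 2 : ℝ) • (t + s) - ξ with hw
  have h1 : ∀ z : Config n, Complex.exp (-2 * Complex.I * Real.pi * (inner ℝ z ξ : ℝ)) *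
      modGauss t (x + (1 / 2 : ℝ) • z) * (starRingEnd ℂ) (modGauss s (x - (1 / 2 : ℝ) • z)) =
      Complex.exp (-(2 * Real.pi) * ‖x‖ ^ 2 + 2 * Real.pi * Complex.I * inner ℝ (t - s) x) *
        Complex.exp (-((Real.pi / 2 : ℝ) : ℂ) * ‖z‖ ^ 2 +
          (2 * Real.pi * Complex.I) * inner ℝ w z) := by
    intro z
    have e1 : (‖x + (1 / 2 : ℝ) • z‖ : ℂ) ^ 2 =
        ‖x‖ ^ 2 + inner ℝ x z + (1 / 4) * ‖z‖ ^ 2 := by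
      have := norm_add_sq_real x ((1 / 2 : ℝ) • z)
      rw [real_inner_smul_right, norm_smul, Real.norm_of_nonneg (by norm_num)] at this
      rw [← Complex.ofReal_pow, this]
      push_cast
      ring
    have e2 : (‖x - (1 / 2 : ℝ) • z‖ : ℂ) ^ 2 =
        ‖x‖ ^ 2 - inner ℝ x z + (1 / 4) * ‖z‖ ^ 2 := by
      have := norm_sub_sq_real x ((1 / 2 : ℝ) • z)
      rw [real_inner_smul_right, norm_smul, Real.norm_of_nonneg (by norm_num)] at this
      rw [← Complex.ofReal_pow, this]
      push_cast
      ring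
    have e3 : (starRingEnd ℂ) (modGauss s (x - (1 / 2 : ℝ) • z)) = Complex.exp
        (-Real.pi * ‖x - (1 / 2 : ℝ) • z‖ ^ 2 -
          2 * Real.pi * Complex.I * inner ℝ s (x - (1 / 2 : ℝ) • z)) := by
      rw [modGauss, ← Complex.exp_conj]
      congr 1
      simp only [map_add, map_mul, map_neg, map_pow, Complex.conj_ofReal, Complex.conj_I,
        Complex.conj_ofNat]
      ring
    rw [e3, modGauss, ← Complex.exp_add, ← Complex.exp_add, ← Complex.exp_add, e1, e2, hw]
    congr 1
    simp only [inner_add_left, inner_add_right, inner_sub_left, inner_sub_right,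
      real_inner_smul_left, real_inner_smul_right, real_inner_comm ξ z]
    push_cast
    ring
  rw [wigner]
  simp only [h1]
  rw [integral_const_mul, GaussianFourier.integral_cexp_neg_mul_sq_norm_add (by
    rw [Complex.ofReal_re]
    positivity), finrank_euclideanSpace_fin]
  have hp : (Real.pi : ℂ) ≠ 0 := by exact_mod_cast Real.pi_ne_zero
  have e4 : (Real.pi / ((Real.pi / 2 : ℝ) : ℂ)) ^ ((n : ℂ) / 2) = (√2 : ℂ) ^ n := by
    have : (Real.pi / ((Real.pi / 2 : ℝ) : ℂ)) = ((2 : ℝ) : ℂ) := by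
      push_cast
      field_simp
    rw [this, show (n : ℂ) / 2 = (((1 / 2 : ℝ) * n : ℝ) : ℂ) by push_cast; ring,
      ← Complex.ofReal_cpow (by norm_num), Real.rpow_mul (by norm_num), ← Real.sqrt_eq_rpow,
      Real.rpow_natCast]
    push_cast
    rfl
  rw [e4, hw, norm_sub_rev _ ξ]
  have e5 : (2 * Real.pi * Complex.I) ^ 2 * (‖ξ - (1 / 2 : ℝ) • (t + s)‖ : ℂ) ^ 2 /
      (4 * ((Real.pi / 2 : ℝ) : ℂ)) = -(2 * Real.pi) * ‖ξ - (1 / 2 : ℝ) • (t + s)‖ ^ 2 := by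
    push_cast
    rw [mul_pow, Complex.I_sq]
    field_simp
    ring
  rw [e5]
  ring

/-- `2π(|x|² + |ξ|²)`. -/
def phaseRadius (p : Config n × Config n) : ℝ := 2 * Real.pi * (‖p.1‖ ^ 2 + ‖p.2‖ ^ 2)

/-- The factor e^{iτρ} merely replaces 2π by 2π(1-iτ) in both Gaussians, so the x and ξ integrals
still separate. -/
theorem wigner_modGauss_eq_mul (t s x ξ : Config n) (τ : ℝ) :
    Complex.exp (Complex.I * τ * phaseRadius (x, ξ)) * wigner (modGauss t) (modGauss s) x ξ =
      (√2 : ℂ) ^ n * Complex.exp (-(Real.pi * ‖t + s‖ ^ 2 / 2)) *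
        (Complex.exp (-(2 * Real.pi * (1 - Complex.I * τ)) * ‖x‖ ^ 2 +
            2 * Real.pi * Complex.I * inner ℝ (t - s) x) *
          Complex.exp (-(2 * Real.pi * (1 - Complex.I * τ)) * ‖ξ‖ ^ 2 +
            2 * Real.pi * inner ℝ (t + s) ξ)) := by
  have e1 : (‖ξ - (1 / 2 : ℝ) • (t + s)‖ : ℂ) ^ 2 =
      ‖ξ‖ ^ 2 - inner ℝ (t + s) ξ + (1 / 4) * ‖t + s‖ ^ 2 := by
    have := norm_sub_sq_real ξ ((1 / 2 : ℝ) • (t + s))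
    rw [real_inner_smul_right, norm_smul, Real.norm_of_nonneg (by norm_num),
      real_inner_comm] at this
    rw [← Complex.ofReal_pow, this]
    push_cast
    ring
  rw [wigner_modGauss, e1, phaseRadius]
  calc _ = (√2 : ℂ) ^ n * (Complex.exp (Complex.I * τ *
        ((2 * Real.pi * (‖x‖ ^ 2 + ‖ξ‖ ^ 2) : ℝ) : ℂ)) *
        Complex.exp (-(2 * Real.pi) * ‖x‖ ^ 2 + 2 * Real.pi * Complex.I * inner ℝ (t - s) x) *
        Complex.exp (-(2 * Real.pi) *
          (‖ξ‖ ^ 2 - inner ℝ (t + s) ξ + (1 / 4) * ‖t + s‖ ^ 2))) := by ring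
    _ = (√2 : ℂ) ^ n * (Complex.exp (-(Real.pi * ‖t + s‖ ^ 2 / 2)) *
        Complex.exp (-(2 * Real.pi * (1 - Complex.I * τ)) * ‖x‖ ^ 2 +
            2 * Real.pi * Complex.I * inner ℝ (t - s) x) *
        Complex.exp (-(2 * Real.pi * (1 - Complex.I * τ)) * ‖ξ‖ ^ 2 +
            2 * Real.pi * inner ℝ (t + s) ξ)) := by
      rw [← Complex.exp_add, ← Complex.exp_add, ← Complex.exp_add, ← Complex.exp_add]
      congr 2
      push_cast
      ring
    _ = _ := by ring

theorem re_two_pi_mul_one_sub_pos (τ : ℝ) : 0 < (2 * Real.pi * (1 - Complex.I * τ) : ℂ).re := by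
  have : (2 * Real.pi * (1 - Complex.I * τ) : ℂ) =
      ((2 * Real.pi : ℝ) : ℂ) * (1 - Complex.I * τ) := by
    push_cast
    ring
  rw [this, Complex.re_ofReal_mul]
  simp [Real.pi_pos]

theorem integrable_wigner_modGauss_mul (t s : Config n) (τ : ℝ) :
    Integrable (fun p : Config n × Config n => Complex.exp (Complex.I * τ * phaseRadius p) *
      wigner (modGauss t) (modGauss s) p.1 p.2) := by
  have h1 := GaussianFourier.integrable_cexp_neg_mul_sq_norm_add (re_two_pi_mul_one_sub_pos τ)
    (2 * Real.pi * Complex.I) (t - s)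
  have h2 := GaussianFourier.integrable_cexp_neg_mul_sq_norm_add (re_two_pi_mul_one_sub_pos τ)
    (2 * Real.pi) (t + s)
  refine ((h1.mul_prod h2).const_mul
    ((√2 : ℂ) ^ n * Complex.exp (-(Real.pi * ‖t + s‖ ^ 2 / 2)))).congr
    (Filter.Eventually.of_forall fun p => ?_)
  exact (wigner_modGauss_eq_mul t s p.1 p.2 τ).symm

theorem integrable_wigner_modGauss (t s : Config n) :
    Integrable (fun p : Config n × Config n => wigner (modGauss t) (modGauss s) p.1 p.2) := by
  simpa using integrable_wigner_modGauss_mul t s 0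

/-- The characteristic function of the radial distribution of `W(g_t, g_s)`. -/
theorem integral_wigner_modGauss_mul (t s : Config n) (τ : ℝ) :
    ∫ p : Config n × Config n, Complex.exp (Complex.I * τ * phaseRadius p) *
      wigner (modGauss t) (modGauss s) p.1 p.2 =
    ((√2)⁻¹ : ℝ) ^ n * Complex.exp (-(Real.pi * (‖s‖ ^ 2 + ‖t‖ ^ 2) / 2)) *
      (((1 - Complex.I * τ) ^ n)⁻¹ * Complex.exp (Real.pi * (inner ℝ s t : ℝ) *
        ((1 + Complex.I * τ) / (1 - Complex.I * τ)))) := by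
  have hc := one_sub_I_mul_ne_zero τ
  have hp : (Real.pi : ℂ) ≠ 0 := by exact_mod_cast Real.pi_ne_zero
  have h2 : ((√2 : ℝ) : ℂ) ≠ 0 := by
    exact_mod_cast (Real.sqrt_pos.2 zero_lt_two).ne'
  have h22 : ((√2 : ℝ) : ℂ) * (√2 : ℝ) = 2 := by
    rw [← Complex.ofReal_mul, Real.mul_self_sqrt zero_le_two]
    rfl
  have e0 : ∀ p : Config n × Config n, Complex.exp (Complex.I * τ * phaseRadius p) *
      wigner (modGauss t) (modGauss s) p.1 p.2 = _ := fun p =>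
    wigner_modGauss_eq_mul t s p.1 p.2 τ
  simp only [e0]
  rw [integral_const_mul]
  have hprod := integral_prod_mul (μ := (volume : Measure (Config n)))
    (ν := (volume : Measure (Config n)))
    (fun x : Config n => Complex.exp (-(2 * Real.pi * (1 - Complex.I * τ)) * ‖x‖ ^ 2 +
            2 * Real.pi * Complex.I * inner ℝ (t - s) x))
    (fun ξ : Config n => Complex.exp (-(2 * Real.pi * (1 - Complex.I * τ)) * ‖ξ‖ ^ 2 +
            2 * Real.pi * inner ℝ (t + s) ξ))
  refine (congrArg _ hprod).trans ?_
  rw [GaussianFourier.integral_cexp_neg_mul_sq_norm_add (re_two_pi_mul_one_sub_pos τ),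
    GaussianFourier.integral_cexp_neg_mul_sq_norm_add (re_two_pi_mul_one_sub_pos τ),
    finrank_euclideanSpace_fin]
  set b : ℂ := Real.pi / (2 * Real.pi * (1 - Complex.I * τ)) with hb
  have hb' : b = (2 * (1 - Complex.I * τ))⁻¹ := by
    rw [hb]
    field_simp
  have hb0 : b ≠ 0 := by
    rw [hb']
    exact inv_ne_zero (mul_ne_zero two_ne_zero hc)
  -- Each of the two Gaussian integrals contributes b^{n/2}; both use the same base, so no choice of
  -- branch survives.
  have hbb : b ^ ((n : ℂ) / 2) * b ^ ((n : ℂ) / 2) = b ^ n := by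
    rw [← Complex.cpow_add _ _ hb0, add_halves, Complex.cpow_natCast]
  have hts : (‖t + s‖ : ℂ) ^ 2 = ‖t‖ ^ 2 + 2 * inner ℝ s t + ‖s‖ ^ 2 := by
    have := norm_add_sq_real t s
    rw [real_inner_comm] at this
    exact_mod_cast this
  have hts' : (‖t - s‖ : ℂ) ^ 2 = ‖t‖ ^ 2 - 2 * inner ℝ s t + ‖s‖ ^ 2 := by
    have := norm_sub_sq_real t s
    rw [real_inner_comm] at this
    exact_mod_cast this
  have hconst : (√2 : ℂ) ^ n * b ^ n = ((√2)⁻¹ : ℝ) ^ n * ((1 - Complex.I * τ) ^ n)⁻¹ := by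
    rw [← inv_pow, ← mul_pow, ← mul_pow, hb']
    congr 1
    push_cast
    field_simp
    linear_combination h22
  -- Since |t+s|² - |t-s|² = 4 s·t, the mixed term is π s·t (2/(1-iτ) - 1) = π s·t (1+iτ)/(1-iτ).
  have hexp : Complex.exp (-(Real.pi * ‖t + s‖ ^ 2 / 2)) *
      Complex.exp ((2 * Real.pi * Complex.I) ^ 2 * ‖t - s‖ ^ 2 /
        (4 * (2 * Real.pi * (1 - Complex.I * τ)))) *
      Complex.exp ((2 * Real.pi : ℂ) ^ 2 * ‖t + s‖ ^ 2 /
        (4 * (2 * Real.pi * (1 - Complex.I * τ)))) =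
      Complex.exp (-(Real.pi * (‖s‖ ^ 2 + ‖t‖ ^ 2) / 2)) *
        Complex.exp (Real.pi * (inner ℝ s t : ℝ) *
        ((1 + Complex.I * τ) / (1 - Complex.I * τ))) := by
    rw [← Complex.exp_add, ← Complex.exp_add, ← Complex.exp_add, mul_pow _ Complex.I, Complex.I_sq,
      hts, hts']
    congr 1
    field_simp
    ring
  calc _ = ((√2 : ℂ) ^ n * (b ^ ((n : ℂ) / 2) * b ^ ((n : ℂ) / 2))) *
      (Complex.exp (-(Real.pi * ‖t + s‖ ^ 2 / 2)) *
      Complex.exp ((2 * Real.pi * Complex.I) ^ 2 * ‖t - s‖ ^ 2 /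
        (4 * (2 * Real.pi * (1 - Complex.I * τ)))) *
      Complex.exp ((2 * Real.pi : ℂ) ^ 2 * ‖t + s‖ ^ 2 /
        (4 * (2 * Real.pi * (1 - Complex.I * τ))))) := by ring
    _ = _ := by
      rw [hbb, hconst, hexp]
      ring

/-- Each slice in ξ lies in a sphere; `Nontrivial` makes even the sphere of radius 0 null. -/
theorem volume_phaseRadius_eq [Nontrivial (Config n)] (a : ℝ) :
    volume {p : Config n × Config n | |phaseRadius p| = a} = 0 := by
  have hm : MeasurableSet {p : Config n × Config n | |phaseRadius p| = a} := by
    refine measurableSet_eq_fun ?_ measurable_const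
    unfold phaseRadius
    fun_prop
  rw [Measure.volume_eq_prod, Measure.measure_prod_null hm]
  refine Filter.Eventually.of_forall fun x => ?_
  refine measure_mono_null (t := Metric.sphere (0 : Config n) √(a / (2 * Real.pi) - ‖x‖ ^ 2))
    (fun ξ hξ => ?_) (Measure.addHaar_sphere _ _ _)
  have h : |phaseRadius (x, ξ)| = a := hξ
  have h0 : 0 ≤ phaseRadius (x, ξ) := by
    unfold phaseRadius
    positivity
  rw [abs_of_nonneg h0, phaseRadius] at h
  rw [mem_sphere_zero_iff_norm, ← h]
  have : 2 * Real.pi * (‖x‖ ^ 2 + ‖ξ‖ ^ 2) / (2 * Real.pi) - ‖x‖ ^ 2 = ‖ξ‖ ^ 2 := by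
    field_simp
    ring
  simp only [this]
  rw [Real.sqrt_sq (norm_nonneg _)]

theorem norm_one_add_div_one_sub (τ : ℝ) :
    ‖(1 + Complex.I * τ) / (1 - Complex.I * τ)‖ = 1 := by
  rw [norm_div, norm_one_add_I_mul, norm_one_sub_I_mul, div_self (sqrt_one_add_sq_pos τ).ne']

/-- Expansion of the integral over the ball in the coefficients `F_{k;n}(a)`. -/
theorem hasSum_ballCoeff (m : ℕ) {a : ℝ} (ha : 0 ≤ a) (t s : Config (m + 1)) :
    HasSum (fun k : ℕ => ballCoeff k (m + 1) a * (((√2)⁻¹ : ℝ) ^ (m + 1) *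
        Complex.exp (-(Real.pi * (‖s‖ ^ 2 + ‖t‖ ^ 2) / 2)) *
        ((Real.pi * (inner ℝ s t : ℝ)) ^ k / (k.factorial : ℂ))))
      (∫ p in phaseBall (m + 1) a, wigner (modGauss t) (modGauss s) p.1 p.2) := by
  set K : ℂ := ((√2)⁻¹ : ℝ) ^ (m + 1) * Complex.exp (-(Real.pi * (‖s‖ ^ 2 + ‖t‖ ^ 2) / 2)) with hK
  set r : ℂ := Real.pi * (inner ℝ s t : ℝ) with hr
  set φ : ℝ → ℂ := fun τ => K * (((1 - Complex.I * τ) ^ (m + 1))⁻¹ *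
    Complex.exp (r * ((1 + Complex.I * τ) / (1 - Complex.I * τ)))) with hφ
  have hpt : ∀ (k : ℕ) (τ : ℝ), coeffIntegrand k (m + 1) a τ * (K * (r ^ k / k.factorial)) =
      sincKer a τ * (K * (((1 - Complex.I * τ) ^ (m + 1))⁻¹ *
        ((r * ((1 + Complex.I * τ) / (1 - Complex.I * τ))) ^ k / k.factorial))) := by
    intro k τ
    have hc := one_sub_I_mul_ne_zero τ
    have hk : (k.factorial : ℂ) ≠ 0 := by exact_mod_cast k.factorial_ne_zero
    rw [coeffIntegrand, sincKer, mul_pow r, div_pow _ _ k, pow_add]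
    field_simp
  have hsum : ∀ τ : ℝ, HasSum (fun k : ℕ => coeffIntegrand k (m + 1) a τ *
      (K * (r ^ k / k.factorial))) (sincKer a τ * φ τ) := by
    intro τ
    simp only [hpt, hφ]
    have h := NormedSpace.expSeries_div_hasSum_exp
      (r * ((1 + Complex.I * τ) / (1 - Complex.I * τ)))
    rw [← Complex.exp_eq_exp_ℂ] at h
    exact ((h.mul_left _).mul_left _).mul_left _
  have hint : ∀ k : ℕ, Integrable (fun τ => coeffIntegrand k (m + 1) a τ *
      (K * (r ^ k / k.factorial))) := fun k => (integrable_coeffIntegrand k m a).mul_const _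
  -- Because |(1+iτ)/(1-iτ)| = 1, one integrable majorant of the coefficient integrands works for
  -- all k, and the factors |r|^k/k! are summable.
  have hsummable : Summable fun k : ℕ =>
      ∫ τ, ‖coeffIntegrand k (m + 1) a τ * (K * (r ^ k / k.factorial))‖ := by
    have h1 : Summable fun k : ℕ => (∫ τ : ℝ, (|a| + 1) / Real.pi * (1 + τ ^ 2)⁻¹) *
        (‖K‖ * (‖r‖ ^ k / k.factorial)) :=
      ((Real.summable_pow_div_factorial ‖r‖).mul_left _).mul_left _
    refine h1.of_nonneg_of_le (fun k => integral_nonneg fun τ => norm_nonneg _) fun k => ?_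
    simp only [norm_mul, norm_div, norm_pow, Complex.norm_natCast]
    rw [integral_mul_const]
    refine mul_le_mul_of_nonneg_right ?_ (by positivity)
    exact integral_mono (integrable_coeffIntegrand k m a).norm (integrable_coeffBound a)
      (norm_coeffIntegrand_le k m a)
  have hφint : Integrable (fun τ => sincKer a τ * φ τ) := by
    refine ((integrable_coeffBound a).const_mul (‖K‖ * Real.exp ‖r‖)).mono' ?_
      (Filter.Eventually.of_forall fun τ => ?_)
    · have := measurable_sincKer a
      exact Measurable.aestronglyMeasurable (by fun_prop)
    · have h1 : ‖Complex.exp (r * ((1 + Complex.I * τ) / (1 - Complex.I * τ)))‖ ≤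
          Real.exp ‖r‖ := by
        refine (Complex.norm_exp_le_exp_norm _).trans_eq ?_
        rw [norm_mul, norm_one_add_div_one_sub, mul_one]
      calc ‖sincKer a τ * φ τ‖ = ‖K‖ * ‖Complex.exp (r *
            ((1 + Complex.I * τ) / (1 - Complex.I * τ)))‖ *
            (‖sincKer a τ‖ * ‖((1 - Complex.I * (τ : ℂ)) ^ (m + 1))⁻¹‖) := by
            simp only [hφ, norm_mul]
            ring
        _ ≤ ‖K‖ * Real.exp ‖r‖ * (‖sincKer a τ‖ * (√(1 + τ ^ 2))⁻¹) := by
            gcongr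
            exact norm_inv_one_sub_I_mul_pow_le m τ
        _ ≤ _ := mul_le_mul_of_nonneg_left (norm_sincKer_le_of_sqrt a τ) (by positivity)
  have hinv := setIntegral_abs_le_eq_integral_sincKer (integrable_wigner_modGauss t s)
    (ρ := phaseRadius) (by unfold phaseRadius; fun_prop) ha (volume_phaseRadius_eq a) (φ := φ)
    (fun τ => (integral_wigner_modGauss_mul t s τ).symm) hφint
  have hset : {p : Config (m + 1) × Config (m + 1) | |phaseRadius p| ≤ a} =
      phaseBall (m + 1) a := by
    ext p
    have h0 : 0 ≤ phaseRadius p := by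
      unfold phaseRadius
      positivity
    change |phaseRadius p| ≤ a ↔ phaseRadius p ≤ a
    rw [abs_of_nonneg h0]
  rw [hset] at hinv
  rw [hinv]
  have h := hasSum_integral_of_summable_integral_norm hint hsummable
  have hts : ∫ τ, ∑' k : ℕ, coeffIntegrand k (m + 1) a τ * (K * (r ^ k / k.factorial)) =
      ∫ τ, sincKer a τ * φ τ :=
    integral_congr_ae (Filter.Eventually.of_forall fun τ => (hsum τ).tsum_eq)
  rw [hts] at h
  simp only [integral_mul_const] at h
  exact h

/-! ### The Weyl quantization of the ball -/

theorem ballForm_modGaussL2 (n : ℕ) (a : ℝ) (t s : Config n) :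
    ballForm n a (modGaussL2 s) (modGaussL2 t) =
      ∫ p in phaseBall n a, wigner (modGauss t) (modGauss s) p.1 p.2 := by
  rw [ballForm_apply]
  refine integral_congr_ae (Filter.Eventually.of_forall fun p => ?_)
  exact wigner_congr (memLp_modGauss t).coeFn_toLp (memLp_modGauss s).coeFn_toLp p.1 p.2

/-- The operator with eigenvalues `F_{|α|;n}(a)` represents the form of the ball. -/
theorem inner_eq_ballForm_of_hasSum (m : ℕ) {a : ℝ} (ha : 0 ≤ a)
    {D : L2 (m + 1) →L[ℂ] L2 (m + 1)}
    (hD : ∀ u, HasSum (fun α => ballCoeff (∑ j, α j) (m + 1) a • hermiteProj α u) (D u))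
    (u v : L2 (m + 1)) : inner ℂ v (D u) = ballForm (m + 1) a v u := by
  have hgauss : ∀ s t, inner ℂ (modGaussL2 s) (D (modGaussL2 t)) =
      ballForm (m + 1) a (modGaussL2 s) (modGaussL2 t) := by
    intro s t
    have h1 := HasSum.level ((hD (modGaussL2 t)).mapL (innerSL ℂ (modGaussL2 s)))
    rw [ballForm_modGaussL2]
    refine (h1.unique ?_)
    refine (hasSum_ballCoeff m ha t s).congr_fun fun k => ?_
    rw [← sum_level_inner_modGaussL2, Finset.mul_sum]
    refine Finset.sum_congr rfl fun α hα => ?_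
    rw [(Finset.mem_piAntidiag.1 hα).1, hermiteProj_apply, innerSL_apply_apply, inner_smul_right,
      inner_smul_right]
    ring
  have hdense : Dense (Submodule.span ℂ
      (Set.range (fun t : Config (m + 1) => modGaussL2 t)) : Set (L2 (m + 1))) :=
    Submodule.dense_iff_topologicalClosure_eq_top.2 topologicalClosure_span_modGaussL2
  have h2 : ∀ s, (innerSL ℂ (modGaussL2 s)).comp D = ballForm (m + 1) a (modGaussL2 s) := by
    intro s
    refine ContinuousLinearMap.ext_on hdense ?_
    rintro _ ⟨t, rfl⟩
    exact hgauss s t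
  have h3 : Continuous fun v : L2 (m + 1) => inner ℂ v (D u) := by fun_prop
  have h4 : Continuous fun v : L2 (m + 1) => ballForm (m + 1) a v u :=
    (ballForm (m + 1) a).continuous.clm_apply continuous_const
  -- The first slot is conjugate-linear: equality extends to the span by induction and to the
  -- closure by continuity.
  refine congrFun (h3.ext_on hdense h4 fun w hw => ?_) v
  induction hw using Submodule.span_induction with
  | mem w hw =>
    obtain ⟨s, rfl⟩ := hw
    exact congrArg (fun L : L2 (m + 1) →L[ℂ] ℂ => L u) (h2 s)
  | zero => simp
  | add w w' _ _ hw hw' =>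
    simp only [inner_add_left, map_add, add_apply] at hw hw' ⊢
    rw [hw, hw']
  | smul c w _ hw =>
    simp only [inner_smul_left, map_smulₛₗ, smul_apply, smul_eq_mul] at hw ⊢
    rw [hw]

theorem exists_ball_operator (m : ℕ) {a : ℝ} (ha : 0 ≤ a) :
    ∃ D : L2 (m + 1) →L[ℂ] L2 (m + 1),
      (∀ u v, inner ℂ v (D u) = ballForm (m + 1) a v u) ∧
      ∀ u, HasSum (fun α => ballCoeff (∑ j, α j) (m + 1) a • hermiteProj α u) (D u) := by
  obtain ⟨C, hC⟩ := norm_ballCoeff_le m a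
  obtain ⟨D, hD⟩ := exists_diagonal_operator
    (F := fun α : Fin (m + 1) → ℕ => ballCoeff (∑ j, α j) (m + 1) a) (C := C) fun α => hC _
  exact ⟨D, inner_eq_ballForm_of_hasSum m ha hD, hD⟩

theorem eq_of_inner_eq_ballForm {n : ℕ} {a : ℝ} {Q D : L2 n →L[ℂ] L2 n}
    (hQ : ∀ u v, inner ℂ v (Q u) = ballForm n a v u)
    (hD : ∀ u v, inner ℂ v (D u) = ballForm n a v u) : Q = D := by
  ext1 u
  exact ext_inner_left ℂ fun v => by rw [hQ, hD]

theorem hasSum_levelProj {m : ℕ} {a : ℝ} {u w : L2 (m + 1)}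
    (h : HasSum (fun α => ballCoeff (∑ j, α j) (m + 1) a • hermiteProj α u) w) :
    HasSum (fun k => ballCoeff k (m + 1) a • levelProj (m + 1) k u) w := by
  refine (HasSum.level h).congr_fun fun k => ?_
  rw [levelProj, sum_apply, Finset.smul_sum]
  refine Finset.sum_congr rfl fun α hα => ?_
  rw [(Finset.mem_piAntidiag.1 hα).1]

theorem inner_hermiteProj_self {n : ℕ} (α : Fin n → ℕ) (u : L2 n) :
    inner ℂ u (hermiteProj α u) = ((‖inner ℂ (hermiteL2 α) u‖ ^ 2 : ℝ) : ℂ) := by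
  rw [hermiteProj_apply, inner_smul_right, ← inner_conj_symm u, Complex.mul_conj']
  push_cast
  rfl

theorem hasSum_norm_inner_hermiteL2_sq {n : ℕ} (u : L2 n) :
    HasSum (fun α : Fin n → ℕ => ‖inner ℂ (hermiteL2 α) u‖ ^ 2) (‖u‖ ^ 2) := by
  have h := (hermiteBasis n).hasSum_inner_mul_inner u u
  rw [← Complex.hasSum_ofReal]
  have e : ((‖u‖ ^ 2 : ℝ) : ℂ) = inner ℂ u u := by
    push_cast
    exact (inner_self_eq_norm_sq_to_K (𝕜 := ℂ) u).symm
  rw [e]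
  refine h.congr_fun fun α => ?_
  rw [hermiteBasis_apply, ← inner_conj_symm u, Complex.conj_mul']
  push_cast
  rfl

theorem hasSum_inner_ball {m : ℕ} {a : ℝ} (ha : 0 ≤ a) {D : L2 (m + 1) →L[ℂ] L2 (m + 1)}
    (hD : ∀ u, HasSum (fun α => ballCoeff (∑ j, α j) (m + 1) a • hermiteProj α u) (D u))
    (u : L2 (m + 1)) :
    HasSum (fun α : Fin (m + 1) → ℕ => (((ballCoeff (∑ j, α j) (m + 1) a).re *
      ‖inner ℂ (hermiteL2 α) u‖ ^ 2 : ℝ) : ℂ)) (inner ℂ u (D u)) := by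
  refine ((hD u).mapL (innerSL ℂ u)).congr_fun fun α => ?_
  rw [innerSL_apply_apply, inner_smul_right, inner_hermiteProj_self, ballCoeff_eq _ m ha,
    Complex.ofReal_re]
  push_cast
  rfl

theorem inner_ball_eq_ofReal {m : ℕ} {a : ℝ} (ha : 0 ≤ a) {D : L2 (m + 1) →L[ℂ] L2 (m + 1)}
    (hD : ∀ u, HasSum (fun α => ballCoeff (∑ j, α j) (m + 1) a • hermiteProj α u) (D u))
    (u : L2 (m + 1)) : ∃ x : ℝ, inner ℂ u (D u) = x ∧
      x ≤ (1 - upperGamma (m + 1 : ℕ) a / Real.Gamma (m + 1 : ℕ)) * ‖u‖ ^ 2 := by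
  have h := hasSum_inner_ball ha hD u
  have h' : HasSum (fun α : Fin (m + 1) → ℕ => (ballCoeff (∑ j, α j) (m + 1) a).re *
      ‖inner ℂ (hermiteL2 α) u‖ ^ 2) (inner ℂ u (D u)).re := by
    simpa only [Complex.ofReal_re] using Complex.hasSum_re h
  refine ⟨_, h.unique (Complex.hasSum_ofReal.2 h'), ?_⟩
  exact hasSum_le (fun α => mul_le_mul_of_nonneg_right (re_ballCoeff_le _ m ha) (sq_nonneg _)) h'
    ((hasSum_norm_inner_hermiteL2_sq u).mul_left _)

/-- Over ℂ positivity is read off the quadratic form: its real values already force symmetry. -/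
theorem le_smul_one_of_inner_le {E : Type*} [NormedAddCommGroup E] [InnerProductSpace ℂ E]
    [CompleteSpace E] {T : E →L[ℂ] E} {c : ℝ}
    (h : ∀ u, ∃ x : ℝ, inner ℂ u (T u) = x ∧ x ≤ c * ‖u‖ ^ 2) : T ≤ (c : ℂ) • 1 := by
  rw [ContinuousLinearMap.le_def, ContinuousLinearMap.isPositive_iff_complex]
  intro u
  obtain ⟨x, hx, hxc⟩ := h u
  have e : inner ℂ (((c : ℂ) • (1 : E →L[ℂ] E) - T) u) u = ((c * ‖u‖ ^ 2 - x : ℝ) : ℂ) := by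
    have hT : inner ℂ (T u) u = (x : ℂ) := by
      rw [← inner_conj_symm, hx, Complex.conj_ofReal]
    rw [sub_apply, smul_apply, one_apply_eq_self, inner_sub_left, hT, inner_smul_left,
      Complex.conj_ofReal, inner_self_eq_norm_sq_to_K]
    push_cast
    rfl
  rw [e, RCLike.re_to_complex, Complex.ofReal_re]
  exact ⟨rfl, sub_nonneg.2 hxc⟩

theorem setIntegral_re_wigner_self {n : ℕ} (a : ℝ) (u : L2 n) :
    ∫ p in phaseBall n a, (wigner u u p.1 p.2).re = (ballForm n a u u).re := by
  rw [ballForm_apply]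
  exact integral_re (integrableOn_wigner u u a)

theorem upperGamma_one_div_Gamma (a : ℝ) :
    upperGamma (1 : ℕ) a / Real.Gamma (1 : ℕ) = Real.exp (-a) := by
  have h := upperGamma_div_Gamma 0 a
  rw [zero_add] at h
  rw [h, polyP_zero_left]
  simp

end WeylBall

end

theorem mainTheorem5 (n : ℕ) (hn : 1 ≤ n) :
    -- the Hermite functions form a Hilbert basis of `L²(ℝⁿ)`
    (Orthonormal ℂ (fun α : Fin n → ℕ => WeylBall.hermiteL2 α) ∧
      (Submodule.span ℂ
        (Set.range (fun α : Fin n → ℕ => WeylBall.hermiteL2 α))).topologicalClosure = ⊤) ∧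
    -- `P_{k;n}` is a polynomial
    (∀ k : ℕ, ∃ p : Polynomial ℝ, ∀ a : ℝ, WeylBall.laguerreP k n a = p.eval a) ∧
    ∀ a : ℝ, 0 ≤ a →
      -- the coefficients `F_{k;n}(a)`
      (∀ k : ℕ,
        Integrable (WeylBall.coeffIntegrand k n a) ∧
        WeylBall.ballCoeff k n a =
          ((1 - Real.exp (-a) * WeylBall.laguerreP k n a : ℝ) : ℂ) ∧
        (WeylBall.ballCoeff k n a).re ≤ 1 - WeylBall.upperGamma n a / Real.Gamma n) ∧
      -- the Weyl quantization exists as a unique bounded operator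
      (∃! Q : WeylBall.L2 n →L[ℂ] WeylBall.L2 n,
        WeylBall.IsWeylQuantization (WeylBall.ballSymbol n a) Q) ∧
      -- spectral decomposition and upper bounds
      (∀ Q : WeylBall.L2 n →L[ℂ] WeylBall.L2 n,
        WeylBall.IsWeylQuantization (WeylBall.ballSymbol n a) Q →
          (∀ u : WeylBall.L2 n,
            HasSum (fun k : ℕ => WeylBall.ballCoeff k n a • WeylBall.levelProj n k u) (Q u)) ∧
          Q ≤ ((1 - WeylBall.upperGamma n a / Real.Gamma n : ℝ) : ℂ) • 1 ∧
          (n = 1 → Q ≤ ((1 - Real.exp (-a) : ℝ) : ℂ) • 1)) ∧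
      -- the resulting bound for integrals of the Wigner distribution over the ball
      (∀ u : WeylBall.L2 n,
        (∀ x ξ : WeylBall.Config n, (WeylBall.wigner u u x ξ).im = 0) ∧
        IntegrableOn (fun p => WeylBall.wigner u u p.1 p.2) (WeylBall.phaseBall n a) ∧
        (∫ p in WeylBall.phaseBall n a, (WeylBall.wigner u u p.1 p.2).re) ≤
          (1 - WeylBall.upperGamma n a / Real.Gamma n) * ‖u‖ ^ 2) := by
  -- Writing n = m + 1 resolves the truncated subtractions n - 1 and k + n - 1 in `laguerreP`.
  obtain ⟨m, rfl⟩ := Nat.exists_eq_add_of_le' hn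
  refine ⟨⟨WeylBall.orthonormal_hermiteL2,
    (Submodule.topologicalClosure_eq_top_iff).2 WeylBall.span_hermiteL2_orthogonal⟩,
    fun k => ⟨WeylBall.polyP k m, WeylBall.laguerreP_eq_eval k m⟩, fun a ha => ?_⟩
  obtain ⟨D, hD, hDsum⟩ := WeylBall.exists_ball_operator m ha
  have hiff := WeylBall.isWeylQuantization_ballSymbol_iff (n := m + 1) a
  have hbound := WeylBall.inner_ball_eq_ofReal ha hDsum
  have hle := WeylBall.le_smul_one_of_inner_le hbound
  refine ⟨fun k => ⟨WeylBall.integrable_coeffIntegrand k m a, ?_,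
    WeylBall.re_ballCoeff_le k m ha⟩, ⟨D, (hiff D).2 hD, fun Q hQ =>
      WeylBall.eq_of_inner_eq_ballForm ((hiff Q).1 hQ) hD⟩, fun Q hQ => ?_, fun u => ?_⟩
  · rw [WeylBall.ballCoeff_eq k m ha, WeylBall.laguerreP_eq_eval]
  · obtain rfl := WeylBall.eq_of_inner_eq_ballForm ((hiff Q).1 hQ) hD
    refine ⟨fun u => WeylBall.hasSum_levelProj (hDsum u), hle, fun h1 => ?_⟩
    obtain rfl : m = 0 := Nat.succ_injective h1
    rwa [WeylBall.upperGamma_one_div_Gamma] at hle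
  · refine ⟨WeylBall.wigner_self_im u, WeylBall.integrableOn_wigner u u a, ?_⟩
    obtain ⟨x, hx, hxle⟩ := hbound u
    rw [WeylBall.setIntegral_re_wigner_self, ← hD, hx, Complex.ofReal_re]
    exact hxle
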